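/- Conventions. For $\mathrm{x}=(x,y)\in\mathbb{R}^2$ let $\mathcal{Q}_1(\mathrm{x})=\{(u,v):u\ge x,\,v\ge y\}$, $\mathcal{Q}_2(\mathrm{x})=\{(u,v):u\le x,\,v\ge y\}$, $\mathcal{Q}_3(\mathrm{x})=\{(u,v):u\le x,\,v\le y\}$, $\mathcal{Q}_4(\mathrm{x})=\{(u,v):u\ge x,\,v\le y\}$, and let $(x,y)\preceq_{se}(s,t)$ mean $x\le s$ and $y\ge t$. A map on $\mathcal{R}$ is a continuous $T=(f,g):\mathcal{R}\to\mathcal{R}$. It is competitive if $f$ is nondecreasing in the first and nonincreasing in the second variable, and $g$ is nonincreasing in the first and nondecreasing in the second variable; it is strongly competitive on a set if all these monotonicities are strict there. A set $A$ is invariant if $T(A)\subset A$. Hypotheses. Let $T$ be a competitive map on a region $\mathcal{R}=I\times K\subset\mathbb{R}^2$ that is a product of two intervals, and let $\overline{\mathrm{x}}\in\mathcal{R}$ be a fixed point of $T$ such that $\Delta:=\mathcal{R}\cap\mathrm{int}(\mathcal{Q}_1(\overline{\mathrm{x}})\cup\mathcal{Q}_3(\overline{\mathrm{x}}))$ is nonempty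 and $T$ is strongly competitive on $\Delta$. Suppose that $T$ has a $C^1$ extension to a neighborhood of $\overline{\mathrm{x}}$, and that the Jacobian $J_T(\overline{\mathrm{x}})$ has real eigenvalues $\lambda,\mu$ with $0<|\lambda|<\mu$ and $|\lambda|<1$, such that the eigenspace $E^\lambda$ is not a coordinate axis. The curve. Consider the curves $\mathcal{C}\subset\mathcal{R}$ through $\overline{\mathrm{x}}$ that are invariant, are contained in the basin of attraction $\{\mathrm{y}\in\mathcal{R}:T^n(\mathrm{y})\to\overline{\mathrm{x}}\}$, are tangential to $E^\lambda$ at $\overline{\mathrm{x}}$, are graphs of a strictly increasing continuous function of the first coordinate on a nondegenerate interval, and are such that every endpoint of $\mathcal{C}$ in $\mathrm{int}\,\mathcal{R}$ is a fixed point or a minimal period-two point of $T$, where in the latter case the set of endpoints of $\mathcal{C}$ is a minimal period-two orbit. (An endpoint is a limit in $\mathbb{R}^2$ of the curve at one of its two ends, whether or not it belongs to $\mathcal{C}$; a curve has no endpoint at an end where it is unbounded.) Let $\mathcal{C}$ be such a curve that is maximal with respect to inclusion among all such curves, and suppose that every endpoint of $\mathcal{C}$ belongs to $\partial\mathcal{R}$.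 (A) $\mathcal{C}$ separates $\mathcal{R}$ into two connected components, that is, $\mathcal{R}\setminus\mathcal{C}$ has exactly two connected components, namely $$\mathcal{W}_-:=\{\mathrm{x}\in\mathcal{R}\setminus\mathcal{C}:\exists\,\mathrm{y}\in\mathcal{C},\ \mathrm{x}\preceq_{se}\mathrm{y}\},\qquad \mathcal{W}_+:=\{\mathrm{x}\in\mathcal{R}\setminus\mathcal{C}:\exists\,\mathrm{y}\in\mathcal{C},\ \mathrm{y}\preceq_{se}\mathrm{x}\},$$ such that: (i) $\mathcal{W}_-$ is invariant, and $\mathrm{dist}(T^n(\mathrm{x}),\mathcal{Q}_2(\overline{\mathrm{x}}))\to0$ as $n\to\infty$ for every $\mathrm{x}\in\mathcal{W}_-$; (ii) $\mathcal{W}_+$ is invariant, and $\mathrm{dist}(T^n(\mathrm{x}),\mathcal{Q}_4(\overline{\mathrm{x}}))\to0$ as $n\to\infty$ for every $\mathrm{x}\in\mathcal{W}_+$. (B) If, in addition, $\overline{\mathrm{x}}$ is an interior point of $\mathcal{R}$ and $T$ is $C^2$ and strongly competitive in a neighborhood of $\overline{\mathrm{x}}$, then $T$ has no periodic points in the boundary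 of $\mathcal{Q}_1(\overline{\mathrm{x}})\cup\mathcal{Q}_3(\overline{\mathrm{x}})$ except for $\overline{\mathrm{x}}$. If moreover the eigenspace $E^\mu$ of $J_T(\overline{\mathrm{x}})$ associated with $\mu$ is not a coordinate axis, then: (iii) for every $\mathrm{x}\in\mathcal{W}_-$ there exists $n_0\in\mathbb{N}$ such that $T^n(\mathrm{x})\in\mathrm{int}\,\mathcal{Q}_2(\overline{\mathrm{x}})$ for $n\ge n_0$; (iv) for every $\mathrm{x}\in\mathcal{W}_+$ there exists $n_0\in\mathbb{N}$ such that $T^n(\mathrm{x})\in\mathrm{int}\,\mathcal{Q}_4(\overline{\mathrm{x}})$ for $n\ge n_0$. -/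

import Mathlib

open Set Filter Topology

/-- The four closed quadrants of the plane relative to a point. -/
def quadrant1 (x : ℝ × ℝ) : Set (ℝ × ℝ) := {u | x.1 ≤ u.1 ∧ x.2 ≤ u.2}

def quadrant2 (x : ℝ × ℝ) : Set (ℝ × ℝ) := {u | u.1 ≤ x.1 ∧ x.2 ≤ u.2}

def quadrant3 (x : ℝ × ℝ) : Set (ℝ × ℝ) := {u | u.1 ≤ x.1 ∧ u.2 ≤ x.2}

def quadrant4 (x : ℝ × ℝ) : Set (ℝ × ℝ) := {u | x.1 ≤ u.1 ∧ u.2 ≤ x.2}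

/-- The South-East partial order. -/
def SELE (x y : ℝ × ℝ) : Prop := x.1 ≤ y.1 ∧ y.2 ≤ x.2

/-- A rectangular region: the cartesian product of two intervals (of any kind). -/
def IsRectangular (R : Set (ℝ × ℝ)) : Prop :=
  ∃ I K : Set ℝ, I.OrdConnected ∧ K.OrdConnected ∧ R = I ×ˢ K

/-- A map on `R`: a continuous function from `R` to `R`. Values outside `R` are irrelevant. -/
def IsMapOn (T : ℝ × ℝ → ℝ × ℝ) (R : Set (ℝ × ℝ)) : Prop :=
  ContinuousOn T R ∧ MapsTo T R R

/-- `T = (f, g)` with `f` nondecreasing in the first and nonincreasing in the second variable,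
`g` nonincreasing in the first and nondecreasing in the second variable, on `B`. -/
def CompetitiveOn (T : ℝ × ℝ → ℝ × ℝ) (B : Set (ℝ × ℝ)) : Prop :=
  (∀ x x' y : ℝ, (x, y) ∈ B → (x', y) ∈ B → x ≤ x' →
    (T (x, y)).1 ≤ (T (x', y)).1 ∧ (T (x', y)).2 ≤ (T (x, y)).2) ∧
  (∀ x y y' : ℝ, (x, y) ∈ B → (x, y') ∈ B → y ≤ y' →
    (T (x, y')).1 ≤ (T (x, y)).1 ∧ (T (x, y)).2 ≤ (T (x, y')).2)

/-- The same with strict monotonicity in each variable. -/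
def StronglyCompetitiveOn (T : ℝ × ℝ → ℝ × ℝ) (B : Set (ℝ × ℝ)) : Prop :=
  (∀ x x' y : ℝ, (x, y) ∈ B → (x', y) ∈ B → x < x' →
    (T (x, y)).1 < (T (x', y)).1 ∧ (T (x', y)).2 < (T (x, y)).2) ∧
  (∀ x y y' : ℝ, (x, y) ∈ B → (x, y') ∈ B → y < y' →
    (T (x, y')).1 < (T (x, y)).1 ∧ (T (x, y)).2 < (T (x, y')).2)

/-- `R ∩ int (Q₁(x) ∪ Q₃(x))`. -/
def deltaRegion (R : Set (ℝ × ℝ)) (x : ℝ × ℝ) : Set (ℝ × ℝ) :=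
  R ∩ interior (quadrant1 x ∪ quadrant3 x)

/-- `T` (defined on `R`) has a `C¹` extension to a neighborhood of `x`. -/
def HasC1ExtensionNear (T : ℝ × ℝ → ℝ × ℝ) (R : Set (ℝ × ℝ)) (x : ℝ × ℝ) : Prop :=
  ∃ (S : ℝ × ℝ → ℝ × ℝ) (U : Set (ℝ × ℝ)),
    IsOpen U ∧ x ∈ U ∧ ContDiffOn ℝ 1 S U ∧ EqOn S T (R ∩ U)

/-- The Jacobian of `T : R → R` at `x`. For `x` in a rectangle `R` with nonempty interior and `T`
with a `C¹` extension near `x`, it is the derivative at `x` of any such extension. -/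
noncomputable def jacobianOn (T : ℝ × ℝ → ℝ × ℝ) (R : Set (ℝ × ℝ)) (x : ℝ × ℝ) :
    Module.End ℝ (ℝ × ℝ) :=
  (fderivWithin ℝ T R x : ℝ × ℝ →ₗ[ℝ] ℝ × ℝ)

/-- A linear subspace of the plane which is one of the two coordinate axes. -/
def IsCoordinateAxis (E : Submodule ℝ (ℝ × ℝ)) : Prop :=
  E = Submodule.span ℝ {((1 : ℝ), (0 : ℝ))} ∨ E = Submodule.span ℝ {((0 : ℝ), (1 : ℝ))}

/-- The standing hypotheses: `T` is a competitive map on the rectangular region `R`, strongly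
competitive on `R ∩ int (Q₁(x) ∪ Q₃(x)) ≠ ∅`, `x` is a fixed point, `T` has a `C¹` extension to
a neighborhood of `x`, and the Jacobian at `x` has real eigenvalues `lam`, `mu` with
`0 < |lam| < mu`, `|lam| < 1`, the eigenspace of `lam` not being a coordinate axis. -/
structure CurveHypotheses (T : ℝ × ℝ → ℝ × ℝ) (R : Set (ℝ × ℝ)) (x : ℝ × ℝ)
    (lam mu : ℝ) : Prop where
  rectangular : IsRectangular R
  isMap : IsMapOn T R
  competitive : CompetitiveOn T R
  mem : x ∈ R
  fixed : T x = x
  delta_nonempty : (deltaRegion R x).Nonempty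
  strong : StronglyCompetitiveOn T (deltaRegion R x)
  extension : HasC1ExtensionNear T R x
  eigenvalue_lam : (jacobianOn T R x).HasEigenvalue lam
  eigenvalue_mu : (jacobianOn T R x).HasEigenvalue mu
  abs_lam_pos : 0 < |lam|
  abs_lam_lt_mu : |lam| < mu
  abs_lam_lt_one : |lam| < 1
  eigenspace_lam : ¬ IsCoordinateAxis ((jacobianOn T R x).eigenspace lam)

/-- Endpoints in the plane of a curve that is the graph of a strictly increasing continuous
function on an interval: the limits of the curve at its two ends. Since the curve increases in
both coordinates, they are its supremum and infimum for the componentwise order (which is the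
order of `ℝ × ℝ`). A curve that is unbounded towards one end has no endpoint there. -/
def IsCurveEndpoint (C : Set (ℝ × ℝ)) (p : ℝ × ℝ) : Prop :=
  IsLUB C p ∨ IsGLB C p

/-- `C ⊆ R` is a curve through `x`, invariant, contained in the basin of attraction of `x`, the
graph of a strictly increasing continuous function on a nondegenerate interval, tangential at `x`
to the eigenspace of `lam`; endpoints of `C` in the interior of `R` are fixed points or minimal
period-two points, and in the latter case the endpoints form a minimal period-two orbit. -/
structure IsInvariantCurve (T : ℝ × ℝ → ℝ × ℝ) (R : Set (ℝ × ℝ)) (x : ℝ × ℝ) (lam : ℝ)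
    (C : Set (ℝ × ℝ)) : Prop where
  subset : C ⊆ R
  mem : x ∈ C
  invariant : MapsTo T C C
  basin : ∀ y ∈ C, Tendsto (fun n : ℕ => T^[n] y) atTop (𝓝 x)
  graph : ∃ (J : Set ℝ) (f : ℝ → ℝ), J.OrdConnected ∧ J.Nontrivial ∧
    StrictMonoOn f J ∧ ContinuousOn f J ∧ C = (fun t => (t, f t)) '' J ∧
    ∃ m : ℝ, HasDerivWithinAt f m J x.1 ∧
      (jacobianOn T R x).eigenspace lam = Submodule.span ℝ {((1 : ℝ), m)}
  endpoint : ∀ p, IsCurveEndpoint C p → p ∈ interior R →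
    T p = p ∨ (T p ≠ p ∧ T (T p) = p ∧ {q | IsCurveEndpoint C q} = {p, T p})

/-- The part of `R \ C` on the North-West side of `C`. -/
def wMinus (R C : Set (ℝ × ℝ)) : Set (ℝ × ℝ) := {x | x ∈ R \ C ∧ ∃ y ∈ C, SELE x y}

/-- The part of `R \ C` on the South-East side of `C`. -/
def wPlus (R C : Set (ℝ × ℝ)) : Set (ℝ × ℝ) := {x | x ∈ R \ C ∧ ∃ y ∈ C, SELE y x}

/-- `C` separates `R` into exactly two connected components, namely `A` and `B`. -/
def SeparatesInto (C R A B : Set (ℝ × ℝ)) : Prop :=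
  A ≠ B ∧ {K | ∃ x ∈ R \ C, K = connectedComponentIn (R \ C) x} = {A, B}

/-! A competitive map preserves the South-East order, whereas two distinct points of an increasing
curve are never comparable in it. Most of the argument plays these two facts against each other.

Separation. By maximality, `C` contains every endpoint lying in `R` (`mem_of_isCurveEndpoint`): an
endpoint in `R` off `C` would lie in `Δ`, strong competitiveness would send it into `int R`, hence
onto `C`, and it could be adjoined. Since the endpoints are in `∂R`, every point of `R \ C` is then
comparable to a point of `C` (`mem_wMinus_or_mem_wPlus`). The two sides are order ideals of opposite
direction in a rectangle, so each is connected, and both are relatively open.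

Invariance (`CurveHypotheses.map_notMem`). Suppose `p ∉ C` is comparable to `y ∈ C` and `T p ∈ C`.
Then `T p = T y`. If `p` is in `Δ`, this contradicts strong competitiveness. Otherwise `p` is
comparable to `x`, so `T p = x`, monotonicity makes `T` constant on the segment from `x` to `p`, and
the Jacobian would be singular, against `lam * mu ≠ 0`. The distance statements follow by comparing
the orbit of `p` with that of `y`, which tends to `x`.

Part (B). Strong competitiveness near `x` sends every point of `Q₂(x)` or `Q₄(x)` other than `x`
into the corresponding open quadrant, which excludes periodic points on the cross through `x`. For
the escape (`exists_mem_quadrant2_of_orbit`), take `y ∈ C` and `z` north-west of it, both near `x`,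
and iterate `T²`. The orbit of `y` is tangent to `E^lam` and shrinks at a rate near `lam²`, while a
left eigenvector shows that `z - y` is multiplied by about `mu²`. The deviation thus outgrows `y -
x`, and the derivative of `T²` then pushes `z` into the open second quadrant. -/

/-- `C` is the graph of the strictly increasing continuous function `f` on the interval `J`. -/
structure IsIncreasingCurve (C : Set (ℝ × ℝ)) (J : Set ℝ) (f : ℝ → ℝ) : Prop where
  ordConnected : J.OrdConnected
  nontrivial : J.Nontrivial
  strictMono : StrictMonoOn f J
  continuousOn : ContinuousOn f J
  eq_image : C = (fun t => (t, f t)) '' J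

/-! ### Increasing curves, their endpoints and their closure -/

namespace IsIncreasingCurve

variable {C : Set (ℝ × ℝ)} {J : Set ℝ} {f : ℝ → ℝ} {p q : ℝ × ℝ}

theorem mem_iff (h : IsIncreasingCurve C J f) : p ∈ C ↔ p.1 ∈ J ∧ f p.1 = p.2 := by
  rw [h.eq_image]
  constructor
  · rintro ⟨t, ht, rfl⟩
    exact ⟨ht, rfl⟩
  · rintro ⟨h1, h2⟩
    exact ⟨p.1, h1, Prod.ext rfl h2⟩

theorem mk_mem (h : IsIncreasingCurve C J f) {t : ℝ} (ht : t ∈ J) : (t, f t) ∈ C :=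
  h.mem_iff.2 ⟨ht, rfl⟩

theorem lt_iff (h : IsIncreasingCurve C J f) (hp : p ∈ C) (hq : q ∈ C) :
    p.1 < q.1 ↔ p.2 < q.2 := by
  obtain ⟨h1, h2⟩ := h.mem_iff.1 hp
  obtain ⟨h3, h4⟩ := h.mem_iff.1 hq
  rw [← h2, ← h4]
  exact (h.strictMono.lt_iff_lt h1 h3).symm

theorem le_iff (h : IsIncreasingCurve C J f) (hp : p ∈ C) (hq : q ∈ C) :
    p.1 ≤ q.1 ↔ p.2 ≤ q.2 := by
  rw [← not_lt, ← not_lt, h.lt_iff hq hp]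

theorem fst_inj (h : IsIncreasingCurve C J f) (hp : p ∈ C) (hq : q ∈ C) (he : p.1 = q.1) :
    p = q := by
  obtain ⟨h1, h2⟩ := h.mem_iff.1 hp
  obtain ⟨h3, h4⟩ := h.mem_iff.1 hq
  exact Prod.ext he (by rw [← h2, ← h4, he])

theorem eq_of_sele (h : IsIncreasingCurve C J f) (hp : p ∈ C) (hq : q ∈ C) (hs : SELE p q) :
    p = q :=
  h.fst_inj hp hq (le_antisymm hs.1 ((h.le_iff hq hp).2 hs.2))

theorem exists_lt (h : IsIncreasingCurve C J f) :
    ∃ y ∈ C, ∃ z ∈ C, y.1 < z.1 ∧ y.2 < z.2 := by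
  obtain ⟨a, ha, b, hb, hab⟩ := h.nontrivial.exists_lt
  exact ⟨_, h.mk_mem ha, _, h.mk_mem hb, hab, h.strictMono ha hb hab⟩

theorem nonempty (h : IsIncreasingCurve C J f) : C.Nonempty := by
  obtain ⟨y, hy, -⟩ := h.exists_lt
  exact ⟨y, hy⟩

theorem fst_image (h : IsIncreasingCurve C J f) : Prod.fst '' C = J := by
  ext t
  constructor
  · rintro ⟨p, hp, rfl⟩
    exact (h.mem_iff.1 hp).1
  · intro ht
    exact ⟨_, h.mk_mem ht, rfl⟩

theorem snd_image (h : IsIncreasingCurve C J f) : Prod.snd '' C = f '' J := by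
  ext t
  constructor
  · rintro ⟨p, hp, rfl⟩
    exact ⟨p.1, (h.mem_iff.1 hp).1, (h.mem_iff.1 hp).2⟩
  · rintro ⟨s, hs, rfl⟩
    exact ⟨_, h.mk_mem hs, rfl⟩

theorem isLUB_iff (h : IsIncreasingCurve C J f) :
    IsLUB C p ↔ IsLUB J p.1 ∧ IsLUB (f '' J) p.2 := by
  rw [isLUB_prod, h.fst_image, h.snd_image]

theorem isGLB_iff (h : IsIncreasingCurve C J f) :
    IsGLB C p ↔ IsGLB J p.1 ∧ IsGLB (f '' J) p.2 := by
  rw [isGLB_prod, h.fst_image, h.snd_image]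

theorem exists_isLUB (h : IsIncreasingCurve C J f) (hb : BddAbove C) : ∃ p, IsLUB C p := by
  obtain ⟨b, hb⟩ := hb
  refine ⟨(sSup J, sSup (f '' J)), h.isLUB_iff.2 ⟨?_, ?_⟩⟩
  · exact isLUB_csSup h.nontrivial.nonempty ⟨b.1, fun t ht => (hb (h.mk_mem ht)).1⟩
  · refine isLUB_csSup (h.nontrivial.nonempty.image f) ⟨b.2, ?_⟩
    rintro _ ⟨t, ht, rfl⟩
    exact (hb (h.mk_mem ht)).2

theorem exists_isGLB (h : IsIncreasingCurve C J f) (hb : BddBelow C) : ∃ p, IsGLB C p := by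
  obtain ⟨b, hb⟩ := hb
  refine ⟨(sInf J, sInf (f '' J)), h.isGLB_iff.2 ⟨?_, ?_⟩⟩
  · exact isGLB_csInf h.nontrivial.nonempty ⟨b.1, fun t ht => (hb (h.mk_mem ht)).1⟩
  · refine isGLB_csInf (h.nontrivial.nonempty.image f) ⟨b.2, ?_⟩
    rintro _ ⟨t, ht, rfl⟩
    exact (hb (h.mk_mem ht)).2

theorem tendsto_isLUB (h : IsIncreasingCurve C J f) (hp : IsLUB C p) (hpJ : p.1 ∉ J) :
    Tendsto f (𝓝[J] p.1) (𝓝 p.2) := by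
  obtain ⟨h1, h2⟩ := h.isLUB_iff.1 hp
  refine tendsto_order.2 ⟨fun a ha => ?_, fun a ha => ?_⟩
  · obtain ⟨_, ⟨t, ht, rfl⟩, hta⟩ := (lt_isLUB_iff h2).1 ha
    have htp : t < p.1 := lt_of_le_of_ne (h1.1 ht) (fun he => hpJ (he ▸ ht))
    filter_upwards [self_mem_nhdsWithin, mem_nhdsWithin_of_mem_nhds (lt_mem_nhds htp)] with s hs hts
    exact hta.trans (h.strictMono ht hs hts)
  · filter_upwards [self_mem_nhdsWithin] with s hs
    exact (h2.1 ⟨s, hs, rfl⟩).trans_lt ha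

theorem tendsto_isGLB (h : IsIncreasingCurve C J f) (hp : IsGLB C p) (hpJ : p.1 ∉ J) :
    Tendsto f (𝓝[J] p.1) (𝓝 p.2) := by
  obtain ⟨h1, h2⟩ := h.isGLB_iff.1 hp
  refine tendsto_order.2 ⟨fun a ha => ?_, fun a ha => ?_⟩
  · filter_upwards [self_mem_nhdsWithin] with s hs
    exact ha.trans_le (h2.1 ⟨s, hs, rfl⟩)
  · obtain ⟨_, ⟨t, ht, rfl⟩, hta⟩ := (isGLB_lt_iff h2).1 ha
    have htp : p.1 < t := lt_of_le_of_ne (h1.1 ht) (fun he => hpJ (he ▸ ht))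
    filter_upwards [self_mem_nhdsWithin, mem_nhdsWithin_of_mem_nhds (gt_mem_nhds htp)] with s hs hts
    exact (h.strictMono hs ht hts).trans hta

/-- If the abscissa of the supremum belonged to `J`, it would be the maximum of `J`, and by
monotonicity `f` would attain its supremum there, placing `p` on the curve. -/
theorem fst_notMem_of_isLUB (h : IsIncreasingCurve C J f) (hp : IsLUB C p) (hpC : p ∉ C) :
    p.1 ∉ J := by
  obtain ⟨h1, h2⟩ := h.isLUB_iff.1 hp
  refine fun hJ => hpC (h.mem_iff.2 ⟨hJ, le_antisymm (h2.1 ⟨_, hJ, rfl⟩) (h2.2 ?_)⟩)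
  rintro _ ⟨t, ht, rfl⟩
  exact h.strictMono.monotoneOn ht hJ (h1.1 ht)

theorem fst_notMem_of_isGLB (h : IsIncreasingCurve C J f) (hp : IsGLB C p) (hpC : p ∉ C) :
    p.1 ∉ J := by
  obtain ⟨h1, h2⟩ := h.isGLB_iff.1 hp
  refine fun hJ => hpC (h.mem_iff.2 ⟨hJ, le_antisymm (h2.2 ?_) (h2.1 ⟨_, hJ, rfl⟩)⟩)
  rintro _ ⟨t, ht, rfl⟩
  exact h.strictMono.monotoneOn hJ ht (h1.1 ht)

theorem fst_notMem_of_isCurveEndpoint (h : IsIncreasingCurve C J f) (hp : IsCurveEndpoint C p)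
    (hpC : p ∉ C) : p.1 ∉ J :=
  hp.elim (fun hp => h.fst_notMem_of_isLUB hp hpC) (fun hp => h.fst_notMem_of_isGLB hp hpC)

/-- Off the curve, the endpoints lie strictly beyond the curve in both coordinates. -/
theorem lt_of_isLUB (h : IsIncreasingCurve C J f) (hp : IsLUB C p) (hpC : p ∉ C) (hq : q ∈ C) :
    q.1 < p.1 ∧ q.2 < p.2 := by
  have hpJ := h.fst_notMem_of_isLUB hp hpC
  obtain ⟨h1, h2⟩ := h.isLUB_iff.1 hp
  obtain ⟨hqJ, hq2⟩ := h.mem_iff.1 hq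
  have hlt : q.1 < p.1 := lt_of_le_of_ne (h1.1 hqJ) (fun he => hpJ (he ▸ hqJ))
  obtain ⟨t, ht, hqt⟩ := (lt_isLUB_iff h1).1 hlt
  refine ⟨hlt, ?_⟩
  rw [← hq2]
  exact (h.strictMono hqJ ht hqt).trans_le (h2.1 ⟨t, ht, rfl⟩)

theorem lt_of_isGLB (h : IsIncreasingCurve C J f) (hp : IsGLB C p) (hpC : p ∉ C) (hq : q ∈ C) :
    p.1 < q.1 ∧ p.2 < q.2 := by
  have hpJ := h.fst_notMem_of_isGLB hp hpC
  obtain ⟨h1, h2⟩ := h.isGLB_iff.1 hp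
  obtain ⟨hqJ, hq2⟩ := h.mem_iff.1 hq
  have hlt : p.1 < q.1 := lt_of_le_of_ne (h1.1 hqJ) (fun he => hpJ (he ▸ hqJ))
  obtain ⟨t, ht, hqt⟩ := (isGLB_lt_iff h1).1 hlt
  refine ⟨hlt, ?_⟩
  rw [← hq2]
  exact (h2.1 ⟨t, ht, rfl⟩).trans_lt (h.strictMono ht hqJ hqt)

theorem fst_mem_closure (h : IsIncreasingCurve C J f) (hp : IsCurveEndpoint C p) :
    p.1 ∈ closure J := by
  rcases hp with hp | hp
  · exact (h.isLUB_iff.1 hp).1.mem_closure h.nontrivial.nonempty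
  · exact (h.isGLB_iff.1 hp).1.mem_closure h.nontrivial.nonempty

theorem mem_closure_of_isCurveEndpoint (h : IsIncreasingCurve C J f) (hp : IsCurveEndpoint C p) :
    p ∈ closure C := by
  by_cases hpC : p ∈ C
  · exact subset_closure hpC
  have hpJ := h.fst_notMem_of_isCurveEndpoint hp hpC
  have hlim : Tendsto f (𝓝[J] p.1) (𝓝 p.2) :=
    hp.elim (fun hp => h.tendsto_isLUB hp hpJ) (fun hp => h.tendsto_isGLB hp hpJ)
  have : (𝓝[J] p.1).NeBot := mem_closure_iff_nhdsWithin_neBot.1 (h.fst_mem_closure hp)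
  have hid : Tendsto (fun t : ℝ => t) (𝓝[J] p.1) (𝓝 p.1) :=
    tendsto_nhdsWithin_of_tendsto_nhds tendsto_id
  refine mem_closure_of_tendsto (hid.prodMk_nhds hlim) ?_
  filter_upwards [self_mem_nhdsWithin] with t ht
  exact h.mk_mem ht

/-- Over `J` the graph is closed by continuity. A limit point whose abscissa is outside the interval
`J` has all of `J` on one side, and monotonicity makes it the supremum or the infimum of the curve.
-/
theorem mem_or_isCurveEndpoint_of_mem_closure (h : IsIncreasingCurve C J f)
    (hp : p ∈ closure C) : p ∈ C ∨ IsCurveEndpoint C p := by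
  obtain ⟨y, hy, hlim⟩ := mem_closure_iff_seq_limit.1 hp
  have h1 : Tendsto (fun n => (y n).1) atTop (𝓝 p.1) := (continuous_fst.tendsto p).comp hlim
  have h2 : Tendsto (fun n => (y n).2) atTop (𝓝 p.2) := (continuous_snd.tendsto p).comp hlim
  have hyJ : ∀ n, (y n).1 ∈ J := fun n => (h.mem_iff.1 (hy n)).1
  have hyf : ∀ n, f (y n).1 = (y n).2 := fun n => (h.mem_iff.1 (hy n)).2
  by_cases hpJ : p.1 ∈ J
  · left
    refine h.mem_iff.2 ⟨hpJ, tendsto_nhds_unique ?_ h2⟩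
    have hw : Tendsto (fun n => (y n).1) atTop (𝓝[J] p.1) :=
      tendsto_nhdsWithin_iff.2 ⟨h1, Eventually.of_forall hyJ⟩
    exact ((h.continuousOn p.1 hpJ).tendsto.comp hw).congr hyf
  right
  by_cases hlt : ∀ t ∈ J, t < p.1
  · left
    constructor
    · intro q hq
      refine ⟨(hlt _ (h.mem_iff.1 hq).1).le, ge_of_tendsto h2 ?_⟩
      filter_upwards [h1.eventually (lt_mem_nhds (hlt _ (h.mem_iff.1 hq).1))] with n hn
      exact ((h.lt_iff hq (hy n)).1 hn).le
    · intro b hb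
      exact le_of_tendsto hlim (Eventually.of_forall fun n => hb (hy n))
  · push Not at hlt
    obtain ⟨s, hs, hps⟩ := hlt
    have hgt : ∀ t ∈ J, p.1 < t := by
      intro t ht
      by_contra hle
      exact hpJ (h.ordConnected.out ht hs ⟨not_lt.1 hle, hps⟩)
    right
    constructor
    · intro q hq
      refine ⟨(hgt _ (h.mem_iff.1 hq).1).le, le_of_tendsto h2 ?_⟩
      filter_upwards [h1.eventually (gt_mem_nhds (hgt _ (h.mem_iff.1 hq).1))] with n hn
      exact ((h.lt_iff (hy n) hq).1 hn).le
    · intro b hb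
      exact ge_of_tendsto hlim (Eventually.of_forall fun n => hb (hy n))

/-- This makes the enlarged curve a competitor of `C` in the maximality argument. -/
theorem insert_endpoint (h : IsIncreasingCurve C J f) (hp : IsCurveEndpoint C p) (hpC : p ∉ C) :
    IsIncreasingCurve (insert p C) (insert p.1 J) (Function.update f p.1 p.2) := by
  have hpJ := h.fst_notMem_of_isCurveEndpoint hp hpC
  have hupd : ∀ t ∈ J, Function.update f p.1 p.2 t = f t := fun t ht =>
    Function.update_of_ne (ne_of_mem_of_not_mem ht hpJ) _ _
  refine ⟨?_, h.nontrivial.mono (subset_insert _ _), ?_, ?_, ?_⟩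
  · refine ⟨?_⟩
    rintro a (rfl | ha) b (rfl | hb) t ⟨hat, htb⟩
    · exact Or.inl (le_antisymm htb hat)
    · rcases hat.eq_or_lt with rfl | hat
      · exact Or.inl rfl
      rcases hp with hp | hp
      · exact absurd (h.lt_of_isLUB hp hpC (h.mk_mem hb)).1 (not_lt.2 (hat.le.trans htb))
      · obtain ⟨c, hc, hct⟩ := (isGLB_lt_iff (h.isGLB_iff.1 hp).1).1 hat
        exact Or.inr (h.ordConnected.out hc hb ⟨hct.le, htb⟩)
    · rcases htb.eq_or_lt with rfl | htb
      · exact Or.inl rfl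
      rcases hp with hp | hp
      · obtain ⟨c, hc, hct⟩ := (lt_isLUB_iff (h.isLUB_iff.1 hp).1).1 htb
        exact Or.inr (h.ordConnected.out ha hc ⟨hat, hct.le⟩)
      · exact absurd (h.lt_of_isGLB hp hpC (h.mk_mem ha)).1 (not_lt.2 (hat.trans htb.le))
    · exact Or.inr (h.ordConnected.out ha hb ⟨hat, htb⟩)
  · rintro a (rfl | ha) b (rfl | hb) hab
    · exact absurd hab (lt_irrefl _)
    · rw [hupd b hb, Function.update_self]
      rcases hp with hp | hp
      · exact absurd (h.lt_of_isLUB hp hpC (h.mk_mem hb)).1 (not_lt.2 hab.le)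
      · exact (h.lt_of_isGLB hp hpC (h.mk_mem hb)).2
    · rw [hupd a ha, Function.update_self]
      rcases hp with hp | hp
      · exact (h.lt_of_isLUB hp hpC (h.mk_mem ha)).2
      · exact absurd (h.lt_of_isGLB hp hpC (h.mk_mem ha)).1 (not_lt.2 hab.le)
    · rw [hupd a ha, hupd b hb]
      exact h.strictMono ha hb hab
  · rw [continuousOn_update_iff, insert_sdiff_self_of_notMem hpJ]
    exact ⟨h.continuousOn, fun _ =>
      hp.elim (fun hp => h.tendsto_isLUB hp hpJ) (fun hp => h.tendsto_isGLB hp hpJ)⟩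
  · rw [image_insert_eq, Function.update_self, h.eq_image]
    congr 1
    exact image_congr fun t ht => by rw [hupd t ht]

theorem isCurveEndpoint_insert (h : IsIncreasingCurve C J f) (hp : IsCurveEndpoint C p) :
    IsCurveEndpoint (insert p C) q ↔ IsCurveEndpoint C q := by
  obtain ⟨y, hy⟩ := h.nonempty
  have hU : upperBounds (insert p C) = upperBounds C := by
    ext b
    rw [upperBounds_insert]
    refine ⟨fun hb => hb.2, fun hb => ⟨?_, hb⟩⟩
    exact hp.elim (fun hp => hp.2 hb) (fun hp => (hp.1 hy).trans (hb hy))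
  have hL : lowerBounds (insert p C) = lowerBounds C := by
    ext b
    rw [lowerBounds_insert]
    refine ⟨fun hb => hb.2, fun hb => ⟨?_, hb⟩⟩
    exact hp.elim (fun hp => (hb hy).trans (hp.1 hy)) (fun hp => hp.2 hb)
  unfold IsCurveEndpoint IsLUB IsGLB
  rw [hU, hL]

end IsIncreasingCurve

/-! ### The South-East order, rectangles and competitive maps -/

theorem SELE.trans {x y z : ℝ × ℝ} (h : SELE x y) (h' : SELE y z) : SELE x z :=
  ⟨h.1.trans h'.1, h'.2.trans h.2⟩

theorem SELE.antisymm {x y : ℝ × ℝ} (h : SELE x y) (h' : SELE y x) : x = y :=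
  Prod.ext (le_antisymm h.1 h'.1) (le_antisymm h'.2 h.2)

theorem IsRectangular.mk_mem {R : Set (ℝ × ℝ)} (hR : IsRectangular R) {p q : ℝ × ℝ} (hp : p ∈ R)
    (hq : q ∈ R) : (p.1, q.2) ∈ R := by
  obtain ⟨I, K, -, -, rfl⟩ := hR
  exact ⟨hp.1, hq.2⟩

theorem IsRectangular.mem_of_mem_uIcc {R : Set (ℝ × ℝ)} (hR : IsRectangular R) {p q z : ℝ × ℝ}
    (hp : p ∈ R) (hq : q ∈ R) (h1 : z.1 ∈ uIcc p.1 q.1) (h2 : z.2 ∈ uIcc p.2 q.2) : z ∈ R := by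
  obtain ⟨I, K, hI, hK, rfl⟩ := hR
  exact ⟨hI.uIcc_subset hp.1 hq.1 h1, hK.uIcc_subset hp.2 hq.2 h2⟩

theorem IsRectangular.convex {R : Set (ℝ × ℝ)} (hR : IsRectangular R) : Convex ℝ R := by
  obtain ⟨I, K, hI, hK, rfl⟩ := hR
  exact hI.convex.prod hK.convex

theorem IsRectangular.mem_interior_of_lt {R : Set (ℝ × ℝ)} (hR : IsRectangular R)
    {a b c d p : ℝ × ℝ}
    (ha : a ∈ R) (hb : b ∈ R) (hc : c ∈ R) (hd : d ∈ R) (hap : a.1 < p.1) (hpb : p.1 < b.1)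
    (hcp : c.2 < p.2) (hpd : p.2 < d.2) : p ∈ interior R := by
  obtain ⟨I, K, hI, hK, rfl⟩ := hR
  rw [interior_prod_eq]
  refine ⟨mem_interior.2 ⟨Ioo a.1 b.1, ?_, isOpen_Ioo, hap, hpb⟩,
    mem_interior.2 ⟨Ioo c.2 d.2, ?_, isOpen_Ioo, hcp, hpd⟩⟩
  · exact Ioo_subset_Icc_self.trans (hI.out ha.1 hb.1)
  · exact Ioo_subset_Icc_self.trans (hK.out hc.2 hd.2)

/-- The two points are joined through the corner `(y.1, x.2)`, changing one coordinate at a time. -/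
theorem CompetitiveOn.sele {T : ℝ × ℝ → ℝ × ℝ} {B : Set (ℝ × ℝ)} (hT : CompetitiveOn T B)
    {x y : ℝ × ℝ} (hx : x ∈ B) (hy : y ∈ B) (hyx : (y.1, x.2) ∈ B) (h : SELE x y) :
    SELE (T x) (T y) :=
  SELE.trans (y := T (y.1, x.2)) (hT.1 x.1 y.1 x.2 hx hyx h.1) (hT.2 y.1 y.2 x.2 hy hyx h.2)

theorem StronglyCompetitiveOn.lt {T : ℝ × ℝ → ℝ × ℝ} {B : Set (ℝ × ℝ)}
    (hT : StronglyCompetitiveOn T B) {x y : ℝ × ℝ} (hx : x ∈ B) (hy : y ∈ B)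
    (hyx : (y.1, x.2) ∈ B) (h : SELE x y) (hne : x ≠ y) :
    (T x).1 < (T y).1 ∧ (T y).2 < (T x).2 := by
  obtain ⟨x1, x2⟩ := x
  obtain ⟨y1, y2⟩ := y
  obtain ⟨h1, h2⟩ := h
  rcases eq_or_lt_of_le h1 with e1 | e1 <;> rcases eq_or_lt_of_le h2 with e2 | e2
  · exact absurd (Prod.ext e1 e2.symm) hne
  · obtain rfl : x1 = y1 := e1
    exact hT.2 _ _ _ hy hyx e2
  · obtain rfl : y2 = x2 := e2
    exact hT.1 _ _ _ hx hyx e1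
  · have a := hT.1 _ _ _ hx hyx e1
    have b := hT.2 _ _ _ hy hyx e2
    exact ⟨a.1.trans b.1, b.2.trans a.2⟩

theorem mem_deltaRegion_of_gt {R : Set (ℝ × ℝ)} {x p : ℝ × ℝ} (hp : p ∈ R) (h1 : x.1 < p.1)
    (h2 : x.2 < p.2) : p ∈ deltaRegion R x := by
  refine ⟨hp, mem_interior.2 ⟨Ioi x.1 ×ˢ Ioi x.2, ?_, isOpen_Ioi.prod isOpen_Ioi, h1, h2⟩⟩
  exact fun q hq => Or.inl ⟨le_of_lt hq.1, le_of_lt hq.2⟩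

theorem mem_deltaRegion_of_lt {R : Set (ℝ × ℝ)} {x p : ℝ × ℝ} (hp : p ∈ R) (h1 : p.1 < x.1)
    (h2 : p.2 < x.2) : p ∈ deltaRegion R x := by
  refine ⟨hp, mem_interior.2 ⟨Iio x.1 ×ˢ Iio x.2, ?_, isOpen_Iio.prod isOpen_Iio, h1, h2⟩⟩
  exact fun q hq => Or.inr ⟨le_of_lt hq.1, le_of_lt hq.2⟩

/-- Moving `p` slightly towards `x`, once horizontally and once vertically, stays in `Δ` and gives
two points of `R` whose images strictly bracket `T p` in both coordinates. -/
theorem mem_interior_of_mapsTo_deltaRegion {T : ℝ × ℝ → ℝ × ℝ} {R : Set (ℝ × ℝ)} {x p : ℝ × ℝ}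
    (hR : IsRectangular R) (hT : MapsTo T R R) (hs : StronglyCompetitiveOn T (deltaRegion R x))
    (hx : x ∈ R) (hp : p ∈ R) (h : (x.1 < p.1 ∧ x.2 < p.2) ∨ (p.1 < x.1 ∧ p.2 < x.2)) :
    T p ∈ interior R := by
  rcases h with ⟨h1, h2⟩ | ⟨h1, h2⟩
  · obtain ⟨a, hxa, hap⟩ := exists_between h1
    obtain ⟨b, hxb, hbp⟩ := exists_between h2
    have ha : (a, p.2) ∈ R := hR.mem_of_mem_uIcc hx hp
      (mem_uIcc_of_le hxa.le hap.le) (mem_uIcc_of_le h2.le le_rfl)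
    have hb : (p.1, b) ∈ R := hR.mem_of_mem_uIcc hx hp
      (mem_uIcc_of_le h1.le le_rfl) (mem_uIcc_of_le hxb.le hbp.le)
    have hpD := mem_deltaRegion_of_gt hp h1 h2
    have h3 := hs.1 a p.1 p.2 (mem_deltaRegion_of_gt ha hxa h2) hpD hap
    have h4 := hs.2 p.1 b p.2 (mem_deltaRegion_of_gt hb h1 hxb) hpD hbp
    exact hR.mem_interior_of_lt (hT ha) (hT hb) (hT hb) (hT ha) h3.1 h4.1 h4.2 h3.2
  · obtain ⟨a, hap, hxa⟩ := exists_between h1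
    obtain ⟨b, hbp, hxb⟩ := exists_between h2
    have ha : (a, p.2) ∈ R := hR.mem_of_mem_uIcc hp hx
      (mem_uIcc_of_le hap.le hxa.le) (mem_uIcc_of_le le_rfl h2.le)
    have hb : (p.1, b) ∈ R := hR.mem_of_mem_uIcc hp hx
      (mem_uIcc_of_le le_rfl h1.le) (mem_uIcc_of_le hbp.le hxb.le)
    have hpD := mem_deltaRegion_of_lt hp h1 h2
    have h3 := hs.1 p.1 a p.2 hpD (mem_deltaRegion_of_lt ha hxa h2) hap
    have h4 := hs.2 p.1 p.2 b hpD (mem_deltaRegion_of_lt hb h1 hxb) hbp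
    exact hR.mem_interior_of_lt (hT hb) (hT ha) (hT ha) (hT hb) h4.1 h3.1 h3.2 h4.2

theorem IsInvariantCurve.exists_isIncreasingCurve {T : ℝ × ℝ → ℝ × ℝ} {R : Set (ℝ × ℝ)}
    {x : ℝ × ℝ} {lam : ℝ} {C : Set (ℝ × ℝ)} (hC : IsInvariantCurve T R x lam C) :
    ∃ (J : Set ℝ) (f : ℝ → ℝ), IsIncreasingCurve C J f ∧
      ∃ m : ℝ, HasDerivWithinAt f m J x.1 ∧
        (jacobianOn T R x).eigenspace lam = Submodule.span ℝ {((1 : ℝ), m)} := by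
  obtain ⟨J, f, h1, h2, h3, h4, h5, h6⟩ := hC.graph
  exact ⟨J, f, ⟨h1, h2, h3, h4, h5⟩, h6⟩

/-! ### Maximality and the endpoints of the curve -/

/-- A maximal curve with endpoints in `∂R` contains its endpoints that belong to `R`. -/
theorem mem_of_isCurveEndpoint {T : ℝ × ℝ → ℝ × ℝ} {R : Set (ℝ × ℝ)} {x : ℝ × ℝ} {lam mu : ℝ}
    (hT : CurveHypotheses T R x lam mu) {C : Set (ℝ × ℝ)}
    (hC : Maximal (IsInvariantCurve T R x lam) C)
    (hend : ∀ p, IsCurveEndpoint C p → p ∈ frontier R) {p : ℝ × ℝ} (hp : IsCurveEndpoint C p)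
    (hpR : p ∈ R) : p ∈ C := by
  by_contra hpC
  obtain ⟨J, f, h, m, hm, hspan⟩ := hC.prop.exists_isIncreasingCurve
  -- An endpoint off the curve lies strictly beyond `x` in both coordinates, hence in `Δ`.
  have hTp : T p ∈ interior R := by
    refine mem_interior_of_mapsTo_deltaRegion hT.rectangular hT.isMap.2 hT.strong hT.mem hpR ?_
    exact hp.imp (fun hp => h.lt_of_isLUB hp hpC hC.prop.mem)
      (fun hp => h.lt_of_isGLB hp hpC hC.prop.mem)
  have hcl : T p ∈ closure C :=
    closure_mono hC.prop.invariant.image_subset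
      (((hT.isMap.1 p hpR).mono hC.prop.subset).mem_closure_image
        (h.mem_closure_of_isCurveEndpoint hp))
  -- `T p` is in the closure of `C`; it is not an endpoint, since endpoints lie on the frontier.
  have hTC : T p ∈ C := by
    refine (h.mem_or_isCurveEndpoint_of_mem_closure hcl).resolve_right fun he => ?_
    exact disjoint_left.1 disjoint_interior_frontier hTp (hend _ he)
  have h' := h.insert_endpoint hp hpC
  have hins : IsInvariantCurve T R x lam (insert p C) := by
    refine ⟨insert_subset hpR hC.prop.subset, Or.inr hC.prop.mem, ?_, ?_, ?_, ?_⟩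
    · rintro y (rfl | hy)
      · exact Or.inr hTC
      · exact Or.inr (hC.prop.invariant hy)
    · rintro y (rfl | hy)
      · exact (tendsto_add_atTop_iff_nat 1).1 (hC.prop.basin _ hTC)
      · exact hC.prop.basin y hy
    · refine ⟨_, _, h'.ordConnected, h'.nontrivial, h'.strictMono, h'.continuousOn, h'.eq_image,
        m, ?_, hspan⟩
      have hpJ := h.fst_notMem_of_isCurveEndpoint hp hpC
      have hupd : ∀ t ∈ J, Function.update f p.1 p.2 t = f t := fun t ht =>
        Function.update_of_ne (ne_of_mem_of_not_mem ht hpJ) _ _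
      exact hasFDerivWithinAt_insert.2 (hm.congr hupd (hupd _ (h.mem_iff.1 hC.prop.mem).1))
    · intro q hq hqR
      rw [h.isCurveEndpoint_insert hp] at hq
      exact absurd (hend q hq) (disjoint_left.1 disjoint_interior_frontier hqR)
  exact hpC (hC.le_of_ge hins (subset_insert p C) (mem_insert p C))

/-! ### Separation of the rectangle by the curve -/

section Separation

variable {R C : Set (ℝ × ℝ)} {J : Set ℝ} {f : ℝ → ℝ} {p : ℝ × ℝ}

/-- Points of `R` beyond `p` in each coordinate, together with points of the curve before `p`, would
bracket `p` and make it interior. -/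
theorem IsIncreasingCurve.extremal_of_isLUB (hR : IsRectangular R) (h : IsIncreasingCurve C J f)
    (hCR : C ⊆ R) (hp : IsLUB C p) (hf : p ∈ frontier R) :
    (∀ z ∈ R, z.1 ≤ p.1) ∨ (∀ z ∈ R, z.2 ≤ p.2) := by
  by_contra! hcon
  obtain ⟨⟨z, hz, hz1⟩, ⟨w, hw, hw2⟩⟩ := hcon
  obtain ⟨y, hy, y', hy', h1, h2⟩ := h.exists_lt
  have hle := hp.1 hy'
  exact disjoint_left.1 disjoint_interior_frontier (hR.mem_interior_of_lt (hCR hy) hz (hCR hy) hw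
    (h1.trans_le hle.1) hz1 (h2.trans_le hle.2) hw2) hf

theorem IsIncreasingCurve.extremal_of_isGLB (hR : IsRectangular R) (h : IsIncreasingCurve C J f)
    (hCR : C ⊆ R) (hp : IsGLB C p) (hf : p ∈ frontier R) :
    (∀ z ∈ R, p.1 ≤ z.1) ∨ (∀ z ∈ R, p.2 ≤ z.2) := by
  by_contra! hcon
  obtain ⟨⟨z, hz, hz1⟩, ⟨w, hw, hw2⟩⟩ := hcon
  obtain ⟨y, hy, y', hy', h1, h2⟩ := h.exists_lt
  have hle := hp.1 hy
  exact disjoint_left.1 disjoint_interior_frontier (hR.mem_interior_of_lt hz (hCR hy') hw (hCR hy')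
    hz1 (hle.1.trans_lt h1) hw2 (hle.2.trans_lt h2)) hf

theorem mem_wMinus_of_sele {x z : ℝ × ℝ} (h : IsIncreasingCurve C J f) (hz : z ∈ R)
    (hzx : SELE z x) (hx : x ∈ wMinus R C) : z ∈ wMinus R C := by
  obtain ⟨⟨hxR, hxC⟩, y, hy, hxy⟩ := hx
  refine ⟨⟨hz, fun hzC => hxC ?_⟩, y, hy, hzx.trans hxy⟩
  have := h.eq_of_sele hzC hy (hzx.trans hxy)
  subst this
  rwa [hxy.antisymm hzx]

theorem mem_wPlus_of_sele {x z : ℝ × ℝ} (h : IsIncreasingCurve C J f) (hz : z ∈ R)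
    (hxz : SELE x z) (hx : x ∈ wPlus R C) : z ∈ wPlus R C := by
  obtain ⟨⟨hxR, hxC⟩, y, hy, hyx⟩ := hx
  refine ⟨⟨hz, fun hzC => hxC ?_⟩, y, hy, hyx.trans hxz⟩
  have := h.eq_of_sele hy hzC (hyx.trans hxz)
  subst this
  rwa [hxz.antisymm hyx]

theorem sele_of_mem_segment {x z w : ℝ × ℝ} (h : SELE z x) (hw : w ∈ segment ℝ z x) :
    SELE w x ∧ SELE z w := by
  obtain ⟨a, b, ha, hb, hab, rfl⟩ := hw
  obtain rfl : a = 1 - b := by linarith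
  obtain ⟨h1, h2⟩ := h
  simp only [SELE, Prod.fst_add, Prod.snd_add, Prod.smul_fst, Prod.smul_snd, smul_eq_mul]
  refine ⟨⟨?_, ?_⟩, ?_, ?_⟩ <;> nlinarith

/-- `wMinus` is closed under passing north-west within `R`, so two of its points are joined by
segments to their common bound `(min, max)`, which lies in the rectangle. -/
theorem isPreconnected_wMinus (hR : IsRectangular R) (h : IsIncreasingCurve C J f) :
    IsPreconnected (wMinus R C) := by
  refine isPreconnected_of_forall_pair fun x hx y hy => ?_
  have key : ∀ u ∈ wMinus R C, ∀ z ∈ R, SELE z u → segment ℝ z u ⊆ wMinus R C :=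
    fun u hu z hz hzu w hw => mem_wMinus_of_sele h (hR.convex.segment_subset hz hu.1.1 hw)
      (sele_of_mem_segment hzu hw).1 hu
  have hz : (min x.1 y.1, max x.2 y.2) ∈ R := by
    refine hR.mem_of_mem_uIcc hx.1.1 hy.1.1 ⟨le_rfl, min_le_max⟩ ⟨min_le_max, le_rfl⟩
  refine ⟨_, union_subset (key x hx _ hz ⟨min_le_left _ _, le_max_left _ _⟩)
    (key y hy _ hz ⟨min_le_right _ _, le_max_right _ _⟩), Or.inl (right_mem_segment ℝ _ _),
    Or.inr (right_mem_segment ℝ _ _), ?_⟩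
  exact IsPreconnected.union _ (left_mem_segment ℝ _ _) (left_mem_segment ℝ _ _)
    (convex_segment _ _).isPreconnected (convex_segment _ _).isPreconnected

theorem isPreconnected_wPlus (hR : IsRectangular R) (h : IsIncreasingCurve C J f) :
    IsPreconnected (wPlus R C) := by
  refine isPreconnected_of_forall_pair fun x hx y hy => ?_
  have key : ∀ u ∈ wPlus R C, ∀ z ∈ R, SELE u z → segment ℝ u z ⊆ wPlus R C :=
    fun u hu z hz huz w hw => mem_wPlus_of_sele h (hR.convex.segment_subset hu.1.1 hz hw)
      (sele_of_mem_segment huz hw).2 hu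
  have hz : (max x.1 y.1, min x.2 y.2) ∈ R := by
    refine hR.mem_of_mem_uIcc hx.1.1 hy.1.1 ⟨min_le_max, le_rfl⟩ ⟨le_rfl, min_le_max⟩
  refine ⟨_, union_subset (key x hx _ hz ⟨le_max_left _ _, min_le_left _ _⟩)
    (key y hy _ hz ⟨le_max_right _ _, min_le_right _ _⟩), Or.inl (left_mem_segment ℝ _ _),
    Or.inr (left_mem_segment ℝ _ _), ?_⟩
  exact IsPreconnected.union _ (right_mem_segment ℝ _ _) (right_mem_segment ℝ _ _)
    (convex_segment _ _).isPreconnected (convex_segment _ _).isPreconnected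

theorem disjoint_wMinus_wPlus (h : IsIncreasingCurve C J f) :
    Disjoint (wMinus R C) (wPlus R C) := by
  refine disjoint_left.2 ?_
  rintro x ⟨⟨-, hxC⟩, y, hy, hxy⟩ ⟨-, z, hz, hzx⟩
  have := h.eq_of_sele hz hy (hzx.trans hxy)
  subst this
  exact hxC (hxy.antisymm hzx ▸ hy)

theorem nonempty_wMinus (hR : IsRectangular R) (h : IsIncreasingCurve C J f) (hCR : C ⊆ R) :
    (wMinus R C).Nonempty := by
  obtain ⟨y, hy, y', hy', h1, h2⟩ := h.exists_lt
  have hs : SELE (y.1, y'.2) y := ⟨le_rfl, h2.le⟩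
  refine ⟨(y.1, y'.2), ⟨hR.mk_mem (hCR hy) (hCR hy'), fun hC => ?_⟩, y, hy, hs⟩
  have := congrArg Prod.snd (h.eq_of_sele hC hy hs)
  exact h2.ne' this

theorem nonempty_wPlus (hR : IsRectangular R) (h : IsIncreasingCurve C J f) (hCR : C ⊆ R) :
    (wPlus R C).Nonempty := by
  obtain ⟨y, hy, y', hy', h1, h2⟩ := h.exists_lt
  have hs : SELE y (y'.1, y.2) := ⟨h1.le, le_rfl⟩
  refine ⟨(y'.1, y.2), ⟨hR.mk_mem (hCR hy') (hCR hy), fun hC => ?_⟩, y, hy, hs⟩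
  have := congrArg Prod.fst (h.eq_of_sele hy hC hs)
  exact h1.ne this

/-- Only a point `x` with abscissa outside `J` needs an argument. If it is comparable to no point of
`C`, it bounds the whole curve in both coordinates; the endpoint on that side exists, lies in `R`,
hence on `C`, and `x` strictly exceeds it in a coordinate where it is extremal in `R`. -/
theorem mem_wMinus_or_mem_wPlus (hR : IsRectangular R) (h : IsIncreasingCurve C J f)
    (hCR : C ⊆ R) (hend : ∀ p, IsCurveEndpoint C p → p ∈ frontier R)
    (hmem : ∀ p, IsCurveEndpoint C p → p ∈ R → p ∈ C) {x : ℝ × ℝ} (hx : x ∈ R \ C) :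
    x ∈ wMinus R C ∨ x ∈ wPlus R C := by
  by_cases hxJ : x.1 ∈ J
  · rcases le_total x.2 (f x.1) with hle | hle
    · exact Or.inr ⟨hx, _, h.mk_mem hxJ, le_rfl, hle⟩
    · exact Or.inl ⟨hx, _, h.mk_mem hxJ, le_rfl, hle⟩
  obtain ⟨y₀, hy₀⟩ := h.nonempty
  have hJ : ∀ y ∈ C, y.1 ≠ x.1 := fun y hy he => hxJ (he ▸ (h.mem_iff.1 hy).1)
  by_contra hcon
  have hm : ∀ y ∈ C, x.1 < y.1 → x.2 < y.2 := fun y hy h1 => by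
    by_contra h2
    exact hcon (Or.inl ⟨hx, y, hy, h1.le, not_lt.1 h2⟩)
  have hp : ∀ y ∈ C, y.1 < x.1 → y.2 < x.2 := fun y hy h1 => by
    by_contra h2
    exact hcon (Or.inr ⟨hx, y, hy, h1.le, not_lt.1 h2⟩)
  by_cases hall : ∀ y ∈ C, y.1 < x.1
  · have hub : x ∈ upperBounds C := fun y hy => ⟨(hall y hy).le, (hp y hy (hall y hy)).le⟩
    obtain ⟨p, hpl⟩ := h.exists_isLUB ⟨x, hub⟩
    have hpx := hpl.2 hub
    have hyp := hpl.1 hy₀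
    have hpR : p ∈ R := hR.mem_of_mem_uIcc (hCR hy₀) hx.1 (mem_uIcc_of_le hyp.1 hpx.1)
      (mem_uIcc_of_le hyp.2 hpx.2)
    have hpC := hmem p (Or.inl hpl) hpR
    rcases h.extremal_of_isLUB hR hCR hpl (hend p (Or.inl hpl)) with hl | hl
    · exact (hl x hx.1).not_gt (hall p hpC)
    · exact (hl x hx.1).not_gt (hp p hpC (hall p hpC))
  · push Not at hall
    obtain ⟨z, hz, hzx⟩ := hall
    have hall : ∀ y ∈ C, x.1 < y.1 := by
      intro y hy
      by_contra hle
      exact hxJ (h.ordConnected.out (h.mem_iff.1 hy).1 (h.mem_iff.1 hz).1 ⟨not_lt.1 hle, hzx⟩)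
    have hlb : x ∈ lowerBounds C := fun y hy => ⟨(hall y hy).le, (hm y hy (hall y hy)).le⟩
    obtain ⟨p, hpl⟩ := h.exists_isGLB ⟨x, hlb⟩
    have hpx := hpl.2 hlb
    have hyp := hpl.1 hy₀
    have hpR : p ∈ R := hR.mem_of_mem_uIcc hx.1 (hCR hy₀) (mem_uIcc_of_le hpx.1 hyp.1)
      (mem_uIcc_of_le hpx.2 hyp.2)
    have hpC := hmem p (Or.inr hpl) hpR
    rcases h.extremal_of_isGLB hR hCR hpl (hend p (Or.inr hpl)) with hl | hl
    · exact (hl x hx.1).not_gt (hall p hpC)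
    · exact (hl x hx.1).not_gt (hm p hpC (hall p hpC))

/-- A point of the curve other than its last point has points of the curve slightly beyond it. -/
theorem IsIncreasingCurve.exists_gt (h : IsIncreasingCurve C J f) {y : ℝ × ℝ} (hy : y ∈ C)
    (hne : ¬ IsLUB C y) {a : ℝ × ℝ} (h1 : y.1 < a.1) (h2 : y.2 < a.2) :
    ∃ z ∈ C, y.1 < z.1 ∧ z.1 < a.1 ∧ y.2 < z.2 ∧ z.2 < a.2 := by
  obtain ⟨hyJ, hy2⟩ := h.mem_iff.1 hy
  have : ∃ w ∈ C, y.1 < w.1 := by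
    by_contra! hcon
    exact hne ⟨fun w hw => ⟨hcon w hw, (h.le_iff hw hy).1 (hcon w hw)⟩, fun b hb => hb hy⟩
  obtain ⟨w, hw, hyw⟩ := this
  have hwJ := (h.mem_iff.1 hw).1
  have hev : ∀ᶠ t in 𝓝[>] y.1, t < a.1 ∧ t ∈ Ioo y.1 w.1 :=
    Eventually.and (mem_nhdsWithin_of_mem_nhds (gt_mem_nhds h1)) (Ioo_mem_nhdsGT hyw)
  have hsub : Ioo y.1 w.1 ⊆ J := Ioo_subset_Icc_self.trans (h.ordConnected.out hyJ hwJ)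
  have hlim : Tendsto f (𝓝[>] y.1) (𝓝 (f y.1)) := by
    rw [← nhdsWithin_Ioo_eq_nhdsGT hyw]
    exact ((h.continuousOn y.1 hyJ).mono hsub).tendsto
  obtain ⟨t, ⟨hta, ht⟩, hft⟩ := (hev.and (hlim.eventually (gt_mem_nhds (hy2 ▸ h2)))).exists
  exact ⟨_, h.mk_mem (hsub ht), ht.1, hta, (h.lt_iff hy (h.mk_mem (hsub ht))).1 ht.1, hft⟩

theorem IsIncreasingCurve.exists_lt_of_not_isGLB (h : IsIncreasingCurve C J f) {y : ℝ × ℝ}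
    (hy : y ∈ C) (hne : ¬ IsGLB C y) {a : ℝ × ℝ} (h1 : a.1 < y.1) (h2 : a.2 < y.2) :
    ∃ z ∈ C, z.1 < y.1 ∧ a.1 < z.1 ∧ z.2 < y.2 ∧ a.2 < z.2 := by
  obtain ⟨hyJ, hy2⟩ := h.mem_iff.1 hy
  have : ∃ w ∈ C, w.1 < y.1 := by
    by_contra! hcon
    exact hne ⟨fun w hw => ⟨hcon w hw, (h.le_iff hy hw).1 (hcon w hw)⟩, fun b hb => hb hy⟩
  obtain ⟨w, hw, hyw⟩ := this
  have hwJ := (h.mem_iff.1 hw).1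
  have hev : ∀ᶠ t in 𝓝[<] y.1, a.1 < t ∧ t ∈ Ioo w.1 y.1 :=
    Eventually.and (mem_nhdsWithin_of_mem_nhds (lt_mem_nhds h1)) (Ioo_mem_nhdsLT hyw)
  have hsub : Ioo w.1 y.1 ⊆ J := Ioo_subset_Icc_self.trans (h.ordConnected.out hwJ hyJ)
  have hlim : Tendsto f (𝓝[<] y.1) (𝓝 (f y.1)) := by
    rw [← nhdsWithin_Ioo_eq_nhdsLT hyw]
    exact ((h.continuousOn y.1 hyJ).mono hsub).tendsto
  obtain ⟨t, ⟨hta, ht⟩, hft⟩ := (hev.and (hlim.eventually (lt_mem_nhds (hy2 ▸ h2)))).exists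
  exact ⟨_, h.mk_mem (hsub ht), ht.2, hta, (h.lt_iff (h.mk_mem (hsub ht)) hy).1 ht.2, hft⟩

/-- A point strictly south-east of some point of `C` has an open quadrant as neighbourhood. If `x`
shares a coordinate with `y`, sliding `y` along `C` restores strictness; if `y` is the end of the
curve in that direction, its extremality in `R` lets an open half-plane serve instead. -/
theorem exists_isOpen_wPlus (hR : IsRectangular R) (h : IsIncreasingCurve C J f) (hCR : C ⊆ R)
    (hend : ∀ p, IsCurveEndpoint C p → p ∈ frontier R) :
    ∃ O, IsOpen O ∧ wPlus R C ⊆ O ∧ O ∩ (R \ C) ⊆ wPlus R C := by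
  have key : ∀ x ∈ wPlus R C, ∃ O, IsOpen O ∧ x ∈ O ∧ O ∩ (R \ C) ⊆ wPlus R C := by
    rintro x ⟨⟨hxR, hxC⟩, y, hy, h1, h2⟩
    have hbox : ∀ z ∈ C, z.1 < x.1 → x.2 < z.2 →
        ∃ O, IsOpen O ∧ x ∈ O ∧ O ∩ (R \ C) ⊆ wPlus R C := fun z hz hz1 hz2 =>
      ⟨Ioi z.1 ×ˢ Iio z.2, isOpen_Ioi.prod isOpen_Iio, ⟨hz1, hz2⟩,
        fun w hw => ⟨hw.2, z, hz, le_of_lt hw.1.1, le_of_lt hw.1.2⟩⟩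
    rcases eq_or_lt_of_le h1 with h1 | h1 <;> rcases eq_or_lt_of_le h2 with h2 | h2
    · exact absurd (Prod.ext h1 h2.symm ▸ hy) hxC
    · by_cases hg : IsGLB C y
      · have hl : ∀ z ∈ R, y.1 ≤ z.1 := by
          refine (h.extremal_of_isGLB hR hCR hg (hend y (Or.inr hg))).resolve_right fun hl => ?_
          exact (hl x hxR).not_gt h2
        exact ⟨{w | w.2 < y.2}, isOpen_lt continuous_snd continuous_const, h2,
          fun w hw => ⟨hw.2, y, hy, hl w hw.2.1, le_of_lt hw.1⟩⟩
      · obtain ⟨z, hz, hz1, -, -, hz2⟩ :=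
          h.exists_lt_of_not_isGLB hy hg (a := (y.1 - 1, x.2)) (by simp) h2
        exact hbox z hz (h1 ▸ hz1) hz2
    · by_cases hg : IsLUB C y
      · have hl : ∀ z ∈ R, z.2 ≤ y.2 := by
          refine (h.extremal_of_isLUB hR hCR hg (hend y (Or.inl hg))).resolve_left fun hl => ?_
          exact (hl x hxR).not_gt h1
        exact ⟨{w | y.1 < w.1}, isOpen_lt continuous_const continuous_fst, h1,
          fun w hw => ⟨hw.2, y, hy, le_of_lt hw.1, hl w hw.2.1⟩⟩
      · obtain ⟨z, hz, -, hz1, hz2, -⟩ :=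
          h.exists_gt hy hg (a := (x.1, y.2 + 1)) h1 (by simp)
        exact hbox z hz hz1 (h2 ▸ hz2)
    · exact hbox y hy h1 h2
  choose! O hO hxO hOs using key
  refine ⟨⋃ x ∈ wPlus R C, O x, isOpen_biUnion hO, fun x hx => mem_biUnion hx (hxO x hx), ?_⟩
  rintro w ⟨hw, hwR⟩
  obtain ⟨x, hx, hwx⟩ := mem_iUnion₂.1 hw
  exact hOs x hx ⟨hwx, hwR⟩

theorem exists_isOpen_wMinus (hR : IsRectangular R) (h : IsIncreasingCurve C J f) (hCR : C ⊆ R)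
    (hend : ∀ p, IsCurveEndpoint C p → p ∈ frontier R) :
    ∃ O, IsOpen O ∧ wMinus R C ⊆ O ∧ O ∩ (R \ C) ⊆ wMinus R C := by
  have key : ∀ x ∈ wMinus R C, ∃ O, IsOpen O ∧ x ∈ O ∧ O ∩ (R \ C) ⊆ wMinus R C := by
    rintro x ⟨⟨hxR, hxC⟩, y, hy, h1, h2⟩
    have hbox : ∀ z ∈ C, x.1 < z.1 → z.2 < x.2 →
        ∃ O, IsOpen O ∧ x ∈ O ∧ O ∩ (R \ C) ⊆ wMinus R C := fun z hz hz1 hz2 =>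
      ⟨Iio z.1 ×ˢ Ioi z.2, isOpen_Iio.prod isOpen_Ioi, ⟨hz1, hz2⟩,
        fun w hw => ⟨hw.2, z, hz, le_of_lt hw.1.1, le_of_lt hw.1.2⟩⟩
    rcases eq_or_lt_of_le h1 with h1 | h1 <;> rcases eq_or_lt_of_le h2 with h2 | h2
    · exact absurd (Prod.ext h1 h2.symm ▸ hy) hxC
    · by_cases hg : IsLUB C y
      · have hl : ∀ z ∈ R, z.1 ≤ y.1 := by
          refine (h.extremal_of_isLUB hR hCR hg (hend y (Or.inl hg))).resolve_right fun hl => ?_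
          exact (hl x hxR).not_gt h2
        exact ⟨{w | y.2 < w.2}, isOpen_lt continuous_const continuous_snd, h2,
          fun w hw => ⟨hw.2, y, hy, hl w hw.2.1, le_of_lt hw.1⟩⟩
      · obtain ⟨z, hz, hz1, -, -, hz2⟩ :=
          h.exists_gt hy hg (a := (y.1 + 1, x.2)) (by simp) h2
        exact hbox z hz (h1 ▸ hz1) hz2
    · by_cases hg : IsGLB C y
      · have hl : ∀ z ∈ R, y.2 ≤ z.2 := by
          refine (h.extremal_of_isGLB hR hCR hg (hend y (Or.inr hg))).resolve_left fun hl => ?_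
          exact (hl x hxR).not_gt h1
        exact ⟨{w | w.1 < y.1}, isOpen_lt continuous_fst continuous_const, h1,
          fun w hw => ⟨hw.2, y, hy, le_of_lt hw.1, hl w hw.2.1⟩⟩
      · obtain ⟨z, hz, -, hz1, hz2, -⟩ :=
          h.exists_lt_of_not_isGLB hy hg (a := (x.1, y.2 - 1)) h1 (by simp)
        exact hbox z hz hz1 (h2 ▸ hz2)
    · exact hbox y hy h1 h2
  choose! O hO hxO hOs using key
  refine ⟨⋃ x ∈ wMinus R C, O x, isOpen_biUnion hO, fun x hx => mem_biUnion hx (hxO x hx), ?_⟩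
  rintro w ⟨hw, hwR⟩
  obtain ⟨x, hx, hwx⟩ := mem_iUnion₂.1 hw
  exact hOs x hx ⟨hwx, hwR⟩

/-- If a set splits into two nonempty preconnected relatively open pieces, these are its
connected components. -/
theorem separatesInto_of_isOpen {A B : Set (ℝ × ℝ)} (hA : A.Nonempty) (hB : B.Nonempty)
    (hAc : IsPreconnected A) (hBc : IsPreconnected B) (hdis : Disjoint A B)
    (hunion : A ∪ B = R \ C) (hAo : ∃ O, IsOpen O ∧ A ⊆ O ∧ O ∩ (R \ C) ⊆ A)
    (hBo : ∃ O, IsOpen O ∧ B ⊆ O ∧ O ∩ (R \ C) ⊆ B) : SeparatesInto C R A B := by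
  have comp : ∀ A B : Set (ℝ × ℝ), IsPreconnected A → Disjoint A B → A ∪ B = R \ C →
      (∃ O, IsOpen O ∧ A ⊆ O ∧ O ∩ (R \ C) ⊆ A) → (∃ O, IsOpen O ∧ B ⊆ O ∧ O ∩ (R \ C) ⊆ B) →
      ∀ x ∈ A, connectedComponentIn (R \ C) x = A := by
    rintro A B hAc hdis hunion ⟨O, hO, hAO, hOA⟩ ⟨P, hP, hBP, hPB⟩ x hx
    have hAs : A ⊆ R \ C := hunion ▸ subset_union_left
    refine (subset_antisymm (hAc.subset_connectedComponentIn hx hAs) ?_).symm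
    have hK := connectedComponentIn_subset (R \ C) x
    have hxK := mem_connectedComponentIn (hAs hx)
    intro w hw
    by_contra hwA
    have hwB : w ∈ B := (hunion.symm ▸ hK hw : w ∈ A ∪ B).resolve_left hwA
    obtain ⟨v, hvK, hvO, hvP⟩ := isPreconnected_connectedComponentIn (F := R \ C) (x := x) O P
      hO hP (fun v hv => (hunion.symm ▸ hK hv : v ∈ A ∪ B).imp (@hAO v) (@hBP v))
      ⟨x, hxK, hAO hx⟩ ⟨w, hw, hBP hwB⟩
    exact disjoint_left.1 hdis (hOA ⟨hvO, hK hvK⟩) (hPB ⟨hvP, hK hvK⟩)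
  have hcA := comp A B hAc hdis hunion hAo hBo
  have hcB := comp B A hBc hdis.symm (union_comm A B ▸ hunion) hBo hAo
  refine ⟨fun he => ?_, ?_⟩
  · subst he
    exact hA.ne_empty (disjoint_self.1 hdis)
  · ext K
    constructor
    · rintro ⟨x, hx, rfl⟩
      rw [← hunion] at hx
      rcases hx with hx | hx
      · exact Or.inl (hcA x hx)
      · exact Or.inr (hcB x hx)
    · rintro (rfl | rfl)
      · obtain ⟨x, hx⟩ := hA
        exact ⟨x, hunion ▸ Or.inl hx, (hcA x hx).symm⟩
      · obtain ⟨x, hx⟩ := hB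
        exact ⟨x, hunion ▸ Or.inr hx, (hcB x hx).symm⟩

theorem separatesInto_wMinus_wPlus (hR : IsRectangular R) (h : IsIncreasingCurve C J f)
    (hCR : C ⊆ R) (hend : ∀ p, IsCurveEndpoint C p → p ∈ frontier R)
    (hmem : ∀ p, IsCurveEndpoint C p → p ∈ R → p ∈ C) :
    SeparatesInto C R (wMinus R C) (wPlus R C) := by
  refine separatesInto_of_isOpen (nonempty_wMinus hR h hCR) (nonempty_wPlus hR h hCR)
    (isPreconnected_wMinus hR h) (isPreconnected_wPlus hR h) (disjoint_wMinus_wPlus h) ?_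
    (exists_isOpen_wMinus hR h hCR hend) (exists_isOpen_wPlus hR h hCR hend)
  refine subset_antisymm (union_subset (fun x hx => hx.1) fun x hx => hx.1) fun x hx => ?_
  exact mem_wMinus_or_mem_wPlus hR h hCR hend hmem hx

end Separation

/-! ### Invariance of the two sides and behaviour at the fixed point -/

section Dynamics

variable {T : ℝ × ℝ → ℝ × ℝ} {R C : Set (ℝ × ℝ)} {x : ℝ × ℝ} {lam mu : ℝ}

theorem CurveHypotheses.sele (hT : CurveHypotheses T R x lam mu) {p q : ℝ × ℝ} (hp : p ∈ R)
    (hq : q ∈ R) (h : SELE p q) : SELE (T p) (T q) :=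
  hT.competitive.sele hp hq (hT.rectangular.mk_mem hq hp) h

theorem CurveHypotheses.sele_iterate (hT : CurveHypotheses T R x lam mu) {p q : ℝ × ℝ}
    (hp : p ∈ R) (hq : q ∈ R) (h : SELE p q) (n : ℕ) : SELE (T^[n] p) (T^[n] q) := by
  induction n with
  | zero => exact h
  | succ n ih =>
    rw [Function.iterate_succ_apply', Function.iterate_succ_apply']
    exact hT.sele (hT.isMap.2.iterate n hp) (hT.isMap.2.iterate n hq) ih

theorem CurveHypotheses.hasFDerivWithinAt (hT : CurveHypotheses T R x lam mu) :
    HasFDerivWithinAt T (fderivWithin ℝ T R x) R x := by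
  obtain ⟨S, U, hU, hxU, hS, heq⟩ := hT.extension
  have hd : DifferentiableWithinAt ℝ S R x :=
    ((hS.contDiffAt (hU.mem_nhds hxU)).differentiableAt (by simp)).differentiableWithinAt
  refine (hd.congr_of_eventuallyEq ?_ (heq ⟨hT.mem, hxU⟩).symm).hasFDerivWithinAt
  filter_upwards [self_mem_nhdsWithin, mem_nhdsWithin_of_mem_nhds (hU.mem_nhds hxU)] with y hy hyU
  exact (heq ⟨hy, hyU⟩).symm

/-- The entries of the Jacobian in terms of the eigenvalues and the slope of the eigenspace. -/
theorem CurveHypotheses.exists_fderivWithin_apply (hT : CurveHypotheses T R x lam mu) {m : ℝ}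
    (hm : (jacobianOn T R x).eigenspace lam = Submodule.span ℝ {((1 : ℝ), m)}) :
    ∃ b : ℝ, ∀ u v : ℝ, fderivWithin ℝ T R x (u, v) =
      ((lam - b * m) * u + b * v, m * (lam - mu - b * m) * u + (mu + b * m) * v) := by
  set L := fderivWithin ℝ T R x with hL
  obtain ⟨a, c, hac⟩ : ∃ a c, L (1, 0) = (a, c) := ⟨_, _, rfl⟩
  obtain ⟨b, d, hbd⟩ : ∃ b d, L (0, 1) = (b, d) := ⟨_, _, rfl⟩
  have hLuv : ∀ u v : ℝ, L (u, v) = (a * u + b * v, c * u + d * v) := by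
    intro u v
    have : ((u, v) : ℝ × ℝ) = u • (1, 0) + v • (0, 1) := by simp
    rw [this, map_add, map_smul, map_smul, hac, hbd]
    ext <;> simp <;> ring
  have hlam : L (1, m) = lam • ((1 : ℝ), m) := by
    have : ((1 : ℝ), m) ∈ (jacobianOn T R x).eigenspace lam :=
      hm ▸ Submodule.mem_span_singleton_self _
    exact Module.End.mem_eigenspace_iff.1 this
  obtain ⟨⟨p, q⟩, hw⟩ := hT.eigenvalue_mu.exists_hasEigenvector
  have hwmu : L (p, q) = mu • (p, q) := hw.apply_eq_smul
  rw [hLuv] at hlam hwmu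
  simp only [Prod.smul_mk, smul_eq_mul, Prod.mk.injEq, mul_one] at hlam hwmu
  obtain ⟨h1, h2⟩ := hlam
  obtain ⟨h3, h4⟩ := hwmu
  have hlm : lam ≠ mu := ((le_abs_self lam).trans_lt hT.abs_lam_lt_mu).ne
  have hne : q - m * p ≠ 0 := by
    intro h0
    have hq : q = m * p := by linarith
    subst hq
    have hp : p = 0 := by
      have : (lam - mu) * p = 0 := by linear_combination h3 - p * h1
      exact (mul_eq_zero.1 this).resolve_left (sub_ne_zero.2 hlm)
    exact hw.2 (by simp [hp])
  -- The functional `(u, v) ↦ v - m * u` kills the `lam`-eigenvector `(1, m)`, so it is a left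
  -- eigenvector for `mu`; evaluating on a `mu`-eigenvector gives the identity.
  have hd : d - b * m = mu := by
    refine mul_right_cancel₀ hne ?_
    linear_combination h4 - m * h3 - p * h2 + m * p * h1
  refine ⟨b, fun u v => ?_⟩
  rw [hLuv]
  have ha : a = lam - b * m := by linarith
  have hd' : d = mu + b * m := by linarith
  have hc : c = m * (lam - mu - b * m) := by
    rw [hd'] at h2
    linarith
  rw [ha, hd', hc]

theorem CurveHypotheses.eq_zero_of_fderivWithin_eq_zero (hT : CurveHypotheses T R x lam mu)
    {m : ℝ} (hm : (jacobianOn T R x).eigenspace lam = Submodule.span ℝ {((1 : ℝ), m)})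
    {v : ℝ × ℝ} (hv : fderivWithin ℝ T R x v = 0) : v = 0 := by
  obtain ⟨b, hb⟩ := hT.exists_fderivWithin_apply hm
  obtain ⟨u, v⟩ := v
  rw [hb] at hv
  obtain ⟨h1, h2⟩ := Prod.ext_iff.1 hv
  simp only [Prod.fst_zero, Prod.snd_zero] at h1 h2
  have hmu : mu ≠ 0 := (hT.abs_lam_pos.trans hT.abs_lam_lt_mu).ne'
  have hlam : lam ≠ 0 := abs_pos.1 hT.abs_lam_pos
  have h3 : v - m * u = 0 := by
    refine (mul_eq_zero.1 (?_ : mu * (v - m * u) = 0)).resolve_left hmu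
    linear_combination h2 - m * h1
  have hu : u = 0 := by
    refine (mul_eq_zero.1 (?_ : lam * u = 0)).resolve_left hlam
    linear_combination h1 - b * h3
  exact Prod.ext hu (by simp only [Prod.snd_zero]; rw [hu] at h3; linarith)

theorem HasFDerivWithinAt.apply_sub_eq_zero_of_segment {L : ℝ × ℝ →L[ℝ] ℝ × ℝ} {p c : ℝ × ℝ}
    (hL : HasFDerivWithinAt T L R x) (hseg : ∀ t ∈ Icc (0 : ℝ) 1, x + t • (p - x) ∈ R)
    (hconst : ∀ t ∈ Icc (0 : ℝ) 1, T (x + t • (p - x)) = c) : L (p - x) = 0 := by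
  have hpath : HasDerivWithinAt (fun t : ℝ => x + t • (p - x)) (p - x) (Icc 0 1) 0 := by
    simpa using (((hasDerivAt_id (0 : ℝ)).smul_const (p - x)).const_add x).hasDerivWithinAt
  have hL' : HasFDerivWithinAt T L R (x + (0 : ℝ) • (p - x)) := by simpa using hL
  have h1 := hL'.comp_hasDerivWithinAt (0 : ℝ) hpath hseg
  have h2 : HasDerivWithinAt (T ∘ fun t : ℝ => x + t • (p - x)) 0 (Icc 0 1) 0 :=
    (hasDerivWithinAt_const (0 : ℝ) (Icc 0 1) c).congr hconst (hconst 0 (by simp))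
  exact (uniqueDiffOn_Icc zero_lt_one 0 (by simp)).eq_deriv _ h1 h2

/-- On the closed quadrants `Q₂(x)` and `Q₄(x)` only `x` is mapped to `x`. -/
theorem CurveHypotheses.eq_of_map_eq (hT : CurveHypotheses T R x lam mu)
    (hC : IsInvariantCurve T R x lam C) {p : ℝ × ℝ} (hp : p ∈ R) (hs : SELE p x ∨ SELE x p)
    (hTp : T p = x) : p = x := by
  obtain ⟨J, f, h, m, -, hspan⟩ := hC.exists_isIncreasingCurve
  have hseg : ∀ t ∈ Icc (0 : ℝ) 1, x + t • (p - x) ∈ R := fun t ht =>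
    hT.rectangular.convex.add_smul_sub_mem hT.mem hp ht
  refine sub_eq_zero.1 (hT.eq_zero_of_fderivWithin_eq_zero hspan
    (hT.hasFDerivWithinAt.apply_sub_eq_zero_of_segment (c := x) hseg fun t ht => ?_))
  have hmem := hseg t ht
  -- The points of the segment lie between `p` and `x` in the order, so their images are squeezed
  -- between `T p = x` and `T x = x`.
  rcases hs with ⟨h1, h2⟩ | ⟨h1, h2⟩
  · have ha : SELE p (x + t • (p - x)) := by
      constructor <;> simp <;> nlinarith [ht.1, ht.2]
    have hb : SELE (x + t • (p - x)) x := by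
      constructor <;> simp <;> nlinarith [ht.1, ht.2]
    have ha' := hT.sele hp hmem ha
    have hb' := hT.sele hmem hT.mem hb
    rw [hTp] at ha'
    rw [hT.fixed] at hb'
    exact hb'.antisymm ha'
  · have ha : SELE (x + t • (p - x)) p := by
      constructor <;> simp <;> nlinarith [ht.1, ht.2]
    have hb : SELE x (x + t • (p - x)) := by
      constructor <;> simp <;> nlinarith [ht.1, ht.2]
    have ha' := hT.sele hmem hp ha
    have hb' := hT.sele hT.mem hmem hb
    rw [hTp] at ha'
    rw [hT.fixed] at hb'
    exact ha'.antisymm hb'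

theorem quadrant_cases (x p : ℝ × ℝ) : (x.1 < p.1 ∧ x.2 < p.2) ∨ (p.1 < x.1 ∧ p.2 < x.2) ∨
    SELE p x ∨ SELE x p := by
  unfold SELE
  rcases lt_or_ge x.1 p.1 with h1 | h1 <;> rcases lt_or_ge x.2 p.2 with h2 | h2
  · exact Or.inl ⟨h1, h2⟩
  · exact Or.inr (Or.inr (Or.inr ⟨h1.le, h2⟩))
  · exact Or.inr (Or.inr (Or.inl ⟨h1, h2.le⟩))
  · rcases h1.eq_or_lt with h1' | h1'
    · exact Or.inr (Or.inr (Or.inr ⟨h1'.ge, h2⟩))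
    rcases h2.eq_or_lt with h2' | h2'
    · exact Or.inr (Or.inr (Or.inl ⟨h1, h2'.ge⟩))
    · exact Or.inr (Or.inl ⟨h1', h2'⟩)

/-- Points comparable to, but not on, the curve are not mapped to the curve together with the
point they are comparable to. -/
theorem CurveHypotheses.map_notMem (hT : CurveHypotheses T R x lam mu)
    (hC : IsInvariantCurve T R x lam C) {p y : ℝ × ℝ} (hp : p ∈ R) (hpC : p ∉ C) (hy : y ∈ C)
    (hs : SELE p y ∨ SELE y p) : T p ∉ C := by
  intro hTp
  obtain ⟨J, f, h, -⟩ := hC.exists_isIncreasingCurve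
  have hpy : p ≠ y := fun he => hpC (he ▸ hy)
  have hyR := hC.subset hy
  have heq : T p = T y := hs.elim
    (fun hs => h.eq_of_sele hTp (hC.invariant hy) (hT.sele hp hyR hs))
    (fun hs => (h.eq_of_sele (hC.invariant hy) hTp (hT.sele hyR hp hs)).symm)
  have hyp := hT.rectangular.mk_mem hyR hp
  have hpy' := hT.rectangular.mk_mem hp hyR
  have hlt := h.lt_iff hC.mem hy
  have hgt := h.lt_iff hy hC.mem
  -- In `Δ` the point `y` lies in the same open quadrant as `p`, so `T p ≠ T y`; outside `Δ` the
  -- point `p` is comparable to `x`.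
  rcases quadrant_cases x p with ⟨h1, h2⟩ | ⟨h1, h2⟩ | hx
  · rcases hs with hs | hs
    · have hy1 := h1.trans_le hs.1
      have := hT.strong.lt (mem_deltaRegion_of_gt hp h1 h2)
        (mem_deltaRegion_of_gt hyR hy1 (hlt.1 hy1)) (mem_deltaRegion_of_gt hyp hy1 h2) hs hpy
      exact this.1.ne (congrArg Prod.fst heq)
    · have hy2 := h2.trans_le hs.2
      have := hT.strong.lt (mem_deltaRegion_of_gt hyR (hlt.2 hy2) hy2)
        (mem_deltaRegion_of_gt hp h1 h2) (mem_deltaRegion_of_gt hpy' h1 hy2) hs hpy.symm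
      exact this.1.ne' (congrArg Prod.fst heq)
  · rcases hs with hs | hs
    · have hy2 := hs.2.trans_lt h2
      have := hT.strong.lt (mem_deltaRegion_of_lt hp h1 h2)
        (mem_deltaRegion_of_lt hyR (hgt.2 hy2) hy2) (mem_deltaRegion_of_lt hyp (hgt.2 hy2) h2)
        hs hpy
      exact this.1.ne (congrArg Prod.fst heq)
    · have hy1 := hs.1.trans_lt h1
      have := hT.strong.lt (mem_deltaRegion_of_lt hyR hy1 (hgt.1 hy1))
        (mem_deltaRegion_of_lt hp h1 h2) (mem_deltaRegion_of_lt hpy' h1 (hgt.1 hy1)) hs hpy.symm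
      exact this.1.ne' (congrArg Prod.fst heq)
  · have hTx : T p = x := by
      rcases hx with hx | hx
      · exact h.eq_of_sele hTp hC.mem (hT.fixed ▸ hT.sele hp hT.mem hx)
      · exact (h.eq_of_sele hC.mem hTp (hT.fixed ▸ hT.sele hT.mem hp hx)).symm
    exact hpC (hT.eq_of_map_eq hC hp hx hTx ▸ hC.mem)

theorem CurveHypotheses.mapsTo_wMinus (hT : CurveHypotheses T R x lam mu)
    (hC : IsInvariantCurve T R x lam C) : MapsTo T (wMinus R C) (wMinus R C) := by
  rintro p ⟨⟨hp, hpC⟩, y, hy, hs⟩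
  exact ⟨⟨hT.isMap.2 hp, hT.map_notMem hC hp hpC hy (Or.inl hs)⟩, T y, hC.invariant hy,
    hT.sele hp (hC.subset hy) hs⟩

theorem CurveHypotheses.mapsTo_wPlus (hT : CurveHypotheses T R x lam mu)
    (hC : IsInvariantCurve T R x lam C) : MapsTo T (wPlus R C) (wPlus R C) := by
  rintro p ⟨⟨hp, hpC⟩, y, hy, hs⟩
  exact ⟨⟨hT.isMap.2 hp, hT.map_notMem hC hp hpC hy (Or.inr hs)⟩, T y, hC.invariant hy,
    hT.sele (hC.subset hy) hp hs⟩

/-- The nearest point of the quadrant is obtained by truncating coordinates, and the overshoot of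
`p` in each coordinate is at most that of `y`, which lies south-east of it. -/
theorem infDist_quadrant2_le {p y : ℝ × ℝ} (h : SELE p y) :
    Metric.infDist p (quadrant2 x) ≤ dist y x := by
  have hm : (min p.1 x.1, max p.2 x.2) ∈ quadrant2 x := ⟨min_le_right _ _, le_max_right _ _⟩
  refine (Metric.infDist_le_dist_of_mem hm).trans ?_
  rw [Prod.dist_eq, Prod.dist_eq, Real.dist_eq, Real.dist_eq, Real.dist_eq, Real.dist_eq]
  refine max_le_max ?_ ?_
  · rcases le_total p.1 x.1 with h1 | h1
    · simp [h1]
    · rw [min_eq_right h1, abs_of_nonneg (sub_nonneg.2 h1)]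
      exact (sub_le_sub_right h.1 _).trans (le_abs_self _)
  · rcases le_total x.2 p.2 with h1 | h1
    · simp [h1]
    · rw [max_eq_right h1, abs_sub_comm, abs_of_nonneg (sub_nonneg.2 h1), abs_sub_comm]
      exact (sub_le_sub_left h.2 _).trans (le_abs_self _)

theorem infDist_quadrant4_le {p y : ℝ × ℝ} (h : SELE y p) :
    Metric.infDist p (quadrant4 x) ≤ dist y x := by
  have hm : (max p.1 x.1, min p.2 x.2) ∈ quadrant4 x := ⟨le_max_right _ _, min_le_right _ _⟩
  refine (Metric.infDist_le_dist_of_mem hm).trans ?_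
  rw [Prod.dist_eq, Prod.dist_eq, Real.dist_eq, Real.dist_eq, Real.dist_eq, Real.dist_eq]
  refine max_le_max ?_ ?_
  · rcases le_total x.1 p.1 with h1 | h1
    · simp [h1]
    · rw [max_eq_right h1, abs_sub_comm, abs_of_nonneg (sub_nonneg.2 h1), abs_sub_comm]
      exact (sub_le_sub_left h.1 _).trans (le_abs_self _)
  · rcases le_total p.2 x.2 with h1 | h1
    · simp [h1]
    · rw [min_eq_right h1, abs_of_nonneg (sub_nonneg.2 h1)]
      exact (sub_le_sub_right h.2 _).trans (le_abs_self _)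

theorem CurveHypotheses.tendsto_infDist_quadrant2 (hT : CurveHypotheses T R x lam mu)
    (hC : IsInvariantCurve T R x lam C) {p : ℝ × ℝ} (hp : p ∈ wMinus R C) :
    Tendsto (fun n : ℕ => Metric.infDist (T^[n] p) (quadrant2 x)) atTop (𝓝 0) := by
  obtain ⟨⟨hpR, -⟩, y, hy, hs⟩ := hp
  exact squeeze_zero (fun n => Metric.infDist_nonneg)
    (fun n => infDist_quadrant2_le (hT.sele_iterate hpR (hC.subset hy) hs n))
    (tendsto_iff_dist_tendsto_zero.1 (hC.basin y hy))

theorem CurveHypotheses.tendsto_infDist_quadrant4 (hT : CurveHypotheses T R x lam mu)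
    (hC : IsInvariantCurve T R x lam C) {p : ℝ × ℝ} (hp : p ∈ wPlus R C) :
    Tendsto (fun n : ℕ => Metric.infDist (T^[n] p) (quadrant4 x)) atTop (𝓝 0) := by
  obtain ⟨⟨hpR, -⟩, y, hy, hs⟩ := hp
  exact squeeze_zero (fun n => Metric.infDist_nonneg)
    (fun n => infDist_quadrant4_le (hT.sele_iterate (hC.subset hy) hpR hs n))
    (tendsto_iff_dist_tendsto_zero.1 (hC.basin y hy))

/-- A point arbitrarily close to `x` on the open segment from `x` to `p`. -/
theorem exists_mem_near_segment {U : Set (ℝ × ℝ)} (hU : U ∈ 𝓝 x) (p : ℝ × ℝ) :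
    ∃ t ∈ Ioo (0 : ℝ) 1, x + t • (p - x) ∈ U := by
  have hc : ContinuousAt (fun t : ℝ => x + t • (p - x)) 0 := by fun_prop
  have hev : ∀ᶠ t : ℝ in 𝓝[>] 0, x + t • (p - x) ∈ U :=
    (hc.mono_left nhdsWithin_le_nhds).eventually (by simpa using hU)
  obtain ⟨t, ht, ht1⟩ := (hev.and (Ioo_mem_nhdsGT (zero_lt_one (α := ℝ)))).exists
  exact ⟨t, ht1, ht⟩

/-- Strictness is available only near `x`, so a point `q` of the segment close to `x` is inserted:
order gives `T p` north-west of `T q`, and strong competitiveness puts `T q` strictly north-west of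
`x`. -/
theorem CurveHypotheses.map_lt (hT : CurveHypotheses T R x lam mu) {U : Set (ℝ × ℝ)}
    (hU : U ∈ 𝓝 x) (hUR : U ⊆ R) (hs : StronglyCompetitiveOn T U) {p : ℝ × ℝ} (hp : p ∈ R)
    (hpx : SELE p x) (hne : p ≠ x) : (T p).1 < x.1 ∧ x.2 < (T p).2 := by
  obtain ⟨ε, hε, hball⟩ := Metric.mem_nhds_iff.1 hU
  obtain ⟨t, ht, hq⟩ := exists_mem_near_segment (Metric.ball_mem_nhds x hε) p
  set q := x + t • (p - x) with hqdef
  have hpq : SELE p q := by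
    constructor <;> simp [hqdef] <;> nlinarith [ht.1, ht.2, hpx.1, hpx.2]
  have hqx : SELE q x := by
    constructor <;> simp [hqdef] <;> nlinarith [ht.1, ht.2, hpx.1, hpx.2]
  have hqne : q ≠ x := by
    simp [hqdef, ht.1.ne', sub_eq_zero, hne]
  -- Balls of the sup metric are squares, so they contain the corner that `StronglyCompetitiveOn.lt`
  -- requires.
  have hmid : (x.1, q.2) ∈ Metric.ball x ε := by
    rw [Metric.mem_ball, Prod.dist_eq] at hq ⊢
    simpa [hε] using (le_max_right _ _).trans_lt hq
  have h1 := hT.sele hp (hUR (hball hq)) hpq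
  have h2 := hs.lt (hball hq) (hball (Metric.mem_ball_self hε)) (hball hmid) hqx hqne
  rw [hT.fixed] at h2
  exact ⟨h1.1.trans_lt h2.1, h2.2.trans_le h1.2⟩

theorem CurveHypotheses.lt_map (hT : CurveHypotheses T R x lam mu) {U : Set (ℝ × ℝ)}
    (hU : U ∈ 𝓝 x) (hUR : U ⊆ R) (hs : StronglyCompetitiveOn T U) {p : ℝ × ℝ} (hp : p ∈ R)
    (hpx : SELE x p) (hne : p ≠ x) : x.1 < (T p).1 ∧ (T p).2 < x.2 := by
  obtain ⟨ε, hε, hball⟩ := Metric.mem_nhds_iff.1 hU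
  obtain ⟨t, ht, hq⟩ := exists_mem_near_segment (Metric.ball_mem_nhds x hε) p
  set q := x + t • (p - x) with hqdef
  have hpq : SELE q p := by
    constructor <;> simp [hqdef] <;> nlinarith [ht.1, ht.2, hpx.1, hpx.2]
  have hqx : SELE x q := by
    constructor <;> simp [hqdef] <;> nlinarith [ht.1, ht.2, hpx.1, hpx.2]
  have hqne : q ≠ x := by
    simp [hqdef, ht.1.ne', sub_eq_zero, hne]
  have hmid : (q.1, x.2) ∈ Metric.ball x ε := by
    rw [Metric.mem_ball, Prod.dist_eq] at hq ⊢
    simpa [hε] using (le_max_left _ _).trans_lt hq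
  have h1 := hT.sele (hUR (hball hq)) hp hpq
  have h2 := hs.lt (hball (Metric.mem_ball_self hε)) (hball hq) (hball hmid) hqx hqne.symm
  rw [hT.fixed] at h2
  exact ⟨h2.1.trans_le h1.1, h1.2.trans_lt h2.2⟩

theorem CurveHypotheses.iterate_lt (hT : CurveHypotheses T R x lam mu) {U : Set (ℝ × ℝ)}
    (hU : U ∈ 𝓝 x) (hUR : U ⊆ R) (hs : StronglyCompetitiveOn T U) {p : ℝ × ℝ} (hp : p ∈ R)
    (hpx : SELE p x) (hne : p ≠ x) (n : ℕ) :
    (T^[n + 1] p).1 < x.1 ∧ x.2 < (T^[n + 1] p).2 := by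
  induction n with
  | zero => exact hT.map_lt hU hUR hs hp hpx hne
  | succ n ih =>
    rw [Function.iterate_succ_apply']
    exact hT.map_lt hU hUR hs (hT.isMap.2.iterate _ hp) ⟨ih.1.le, ih.2.le⟩
      (fun he => ih.1.ne (congrArg Prod.fst he))

theorem CurveHypotheses.lt_iterate (hT : CurveHypotheses T R x lam mu) {U : Set (ℝ × ℝ)}
    (hU : U ∈ 𝓝 x) (hUR : U ⊆ R) (hs : StronglyCompetitiveOn T U) {p : ℝ × ℝ} (hp : p ∈ R)
    (hpx : SELE x p) (hne : p ≠ x) (n : ℕ) :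
    x.1 < (T^[n + 1] p).1 ∧ (T^[n + 1] p).2 < x.2 := by
  induction n with
  | zero => exact hT.lt_map hU hUR hs hp hpx hne
  | succ n ih =>
    rw [Function.iterate_succ_apply']
    exact hT.lt_map hU hUR hs (hT.isMap.2.iterate _ hp) ⟨ih.1.le, ih.2.le⟩
      (fun he => ih.1.ne' (congrArg Prod.fst he))

theorem eq_or_eq_of_mem_frontier_quadrants {p : ℝ × ℝ}
    (hp : p ∈ frontier (quadrant1 x ∪ quadrant3 x)) : p.1 = x.1 ∨ p.2 = x.2 := by
  by_contra! hne
  have hcl : IsClosed (quadrant1 x ∪ quadrant3 x) := isClosed_Ici.union isClosed_Iic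
  have hni : ¬ p ∈ interior (quadrant1 x ∪ quadrant3 x) := hp.2
  rcases hcl.frontier_subset hp with ⟨h1, h2⟩ | ⟨h1, h2⟩
  · exact hni (mem_deltaRegion_of_gt (mem_univ p) (lt_of_le_of_ne h1 hne.1.symm)
      (lt_of_le_of_ne h2 hne.2.symm)).2
  · exact hni (mem_deltaRegion_of_lt (mem_univ p) (lt_of_le_of_ne h1 hne.1)
      (lt_of_le_of_ne h2 hne.2)).2

/-- The frontier is contained in the cross through `x`, whose points are comparable to `x`. If not
`x`, they have all later iterates in an open quadrant, off the cross, and never return. -/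
theorem CurveHypotheses.eq_of_mem_periodicPts (hT : CurveHypotheses T R x lam mu)
    {U : Set (ℝ × ℝ)} (hU : U ∈ 𝓝 x) (hUR : U ⊆ R) (hs : StronglyCompetitiveOn T U) {p : ℝ × ℝ}
    (hp : p ∈ R) (hf : p ∈ frontier (quadrant1 x ∪ quadrant3 x))
    (hper : p ∈ Function.periodicPts T) : p = x := by
  by_contra hne
  obtain ⟨k, hk, hper⟩ := hper
  obtain ⟨n, rfl⟩ := Nat.exists_eq_succ_of_ne_zero hk.ne'
  have hcross := eq_or_eq_of_mem_frontier_quadrants hf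
  have hit : T^[n + 1] p = p := hper
  have hcase : SELE p x ∨ SELE x p := by
    unfold SELE
    rcases hcross with h | h
    · rcases le_total p.2 x.2 with h2 | h2
      · exact Or.inr ⟨h.ge, h2⟩
      · exact Or.inl ⟨h.le, h2⟩
    · rcases le_total p.1 x.1 with h2 | h2
      · exact Or.inl ⟨h2, h.ge⟩
      · exact Or.inr ⟨h2, h.le⟩
  rcases hcase with hc | hc
  · have := hT.iterate_lt hU hUR hs hp hc hne n
    rw [hit] at this
    exact hcross.elim this.1.ne this.2.ne'
  · have := hT.lt_iterate hU hUR hs hp hc hne n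
    rw [hit] at this
    exact hcross.elim this.1.ne' this.2.ne

end Dynamics

/-! ### Quantitative estimates for orbits near the fixed point -/

theorem HasStrictFDerivAt.exists_pos_norm_sub_le {S : ℝ × ℝ → ℝ × ℝ} {L : ℝ × ℝ →L[ℝ] ℝ × ℝ}
    {x : ℝ × ℝ} (hS : HasStrictFDerivAt S L x) {ε : ℝ} (hε : 0 < ε) :
    ∃ δ > 0, ∀ p q, dist p x < δ → dist q x < δ → ‖S p - S q - L (p - q)‖ ≤ ε * ‖p - q‖ := by
  have h := hS.isLittleO.def hε
  rw [nhds_prod_eq] at h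
  obtain ⟨δ, hδ, h⟩ := Metric.eventually_nhds_iff.1 (nhds_prod_eq (x := x) (y := x) ▸ h)
  refine ⟨δ, hδ, fun p q hp hq => ?_⟩
  exact h (y := (p, q)) (by rw [Prod.dist_eq]; exact max_lt hp hq)

theorem exists_pos_mul_le (X : ℝ) {τ : ℝ} (hτ : 0 < τ) : ∃ ε > 0, ε * X ≤ τ := by
  refine ⟨τ / (|X| + 1), by positivity, ?_⟩
  rw [div_mul_eq_mul_div, div_le_iff₀ (by positivity)]
  nlinarith [le_abs_self X]

/-- Here `(s, t) = y - x`, `(-α, β) = z - y` and `(X, Y) = S z - x`. The linear part moves the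
deviation north-west by at least `κ * (α + β)` in each coordinate; half of this absorbs the
nonlinear error and the rest dominates the terms in `s`. -/
theorem quadrant2_of_large_deviation {a b c d m κ ε η ν s t α β X Y : ℝ} (ha : 0 < a) (hb : 0 < b)
    (hc : 0 < c) (hd : 0 < d) (hκa : κ ≤ a) (hκb : κ ≤ b) (hκc : κ ≤ c) (hκd : κ ≤ d) (hε : 0 < ε)
    (hεκ : ε ≤ κ / 2) (hν : ν = 1 + m + η) (hm : 0 ≤ m) (hη : 0 ≤ η) (hα0 : 0 ≤ α)
    (hβ0 : 0 ≤ β) (htabs : |t| ≤ (m + η) * |s|)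
    (hbig' : ((a + b + c + d) * ν + ε * ν) * |s| < κ / 2 * (α + β))
    (h1 : |X - (a * (s - α) - b * (t + β))| ≤ ε * (|s - α| + |t + β|))
    (h2 : |Y - (d * (t + β) - c * (s - α))| ≤ ε * (|s - α| + |t + β|)) : X < 0 ∧ 0 < Y := by
  have hνpos : 0 < ν := by rw [hν]; positivity
  have hsum : |s - α| + |t + β| ≤ ν * |s| + (α + β) := by
    have e1 := abs_sub s α
    have e2 := abs_add_le t β
    rw [abs_of_nonneg hα0] at e1
    rw [abs_of_nonneg hβ0] at e2
    rw [hν]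
    linarith
  have herr : ε * (|s - α| + |t + β|) ≤ ε * ν * |s| + κ / 2 * (α + β) := by
    have e1 := mul_le_mul_of_nonneg_left hsum hε.le
    have e2 := mul_le_mul_of_nonneg_right hεκ (add_nonneg hα0 hβ0)
    linarith
  have hs0 := abs_nonneg s
  have htν : |t| ≤ ν * |s| := htabs.trans (by rw [hν]; nlinarith)
  have hsν : |s| ≤ ν * |s| := by rw [hν]; nlinarith
  have b1 : a * s ≤ a * (ν * |s|) :=
    mul_le_mul_of_nonneg_left ((le_abs_self _).trans hsν) ha.le
  have b2 : -(b * t) ≤ b * (ν * |s|) := by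
    have := mul_le_mul_of_nonneg_left ((neg_le_abs t).trans htν) hb.le
    linarith
  have b3 : -(d * t) ≤ d * (ν * |s|) := by
    have := mul_le_mul_of_nonneg_left ((neg_le_abs t).trans htν) hd.le
    linarith
  have b4 : c * s ≤ c * (ν * |s|) :=
    mul_le_mul_of_nonneg_left ((le_abs_self _).trans hsν) hc.le
  have p1 := mul_le_mul_of_nonneg_right hκa hα0
  have p2 := mul_le_mul_of_nonneg_right hκb hβ0
  have p3 := mul_le_mul_of_nonneg_right hκc hα0
  have p4 := mul_le_mul_of_nonneg_right hκd hβ0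
  have q0 : 0 ≤ ν * |s| := by positivity
  have q1 : 0 ≤ a * (ν * |s|) := by positivity
  have q2 : 0 ≤ b * (ν * |s|) := by positivity
  have q3 : 0 ≤ c * (ν * |s|) := by positivity
  have q4 : 0 ≤ d * (ν * |s|) := by positivity
  have hGs : ((a + b + c + d) * ν + ε * ν) * |s| = 
      a * (ν * |s|) + b * (ν * |s|) + c * (ν * |s|) + d * (ν * |s|) + ε * ν * |s| := by ring
  have c1 := (abs_le.1 h1).2
  have c2 := (abs_le.1 h2).1
  exact ⟨by linarith, by linarith⟩

theorem abs_sub_add_le_of_deviation {m M η s t α β : ℝ} (hα0 : 0 ≤ α) (hβ0 : 0 ≤ β)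
    (hmη : 0 ≤ m + η) (htabs : |t| ≤ (m + η) * |s|) (hM : α + β ≤ M * |s|) :
    max |s - α| |t + β| ≤ |s| * (1 + m + η + M) := by
  have e1 := abs_sub s α
  have e2 := abs_add_le t β
  rw [abs_of_nonneg hα0] at e1
  rw [abs_of_nonneg hβ0] at e2
  have h2 : 0 ≤ (m + η) * |s| := by positivity
  have h3 : |s| * (1 + m + η + M) = |s| + (m + η) * |s| + M * |s| := by ring
  exact max_le (by linarith) (by linarith [abs_nonneg s])

/-- The functional `v - m * u` is a left eigenvector for `k`. On a north-west deviation `(-α, β)` it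
equals `β + m * α`, which controls `α + β`, so the error costs only `θ`. -/
theorem growth_of_deviation {a b c d m k ε θ α β X Y : ℝ} (hm : 0 < m) (hε : 0 < ε)
    (hdk : d + m * b = k) (hck : c + m * a = m * k)
    (hεm : ε * ((1 + m) * (1 + m⁻¹)) ≤ θ) (hα0 : 0 ≤ α) (hβ0 : 0 ≤ β)
    (h1 : |X - (a * -α - b * β)| ≤ ε * (α + β)) (h2 : |Y - (d * β - c * -α)| ≤ ε * (α + β)) :
    (k - θ) * (β + m * α) ≤ Y - m * X := by
  have hab : α + β ≤ (1 + m⁻¹) * (β + m * α) := by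
    have e : (1 + m⁻¹) * (β + m * α) = β + m * α + m⁻¹ * β + α := by
      field_simp
      ring
    rw [e]
    have e1 : 0 ≤ m * α := by positivity
    have e2 : 0 ≤ m⁻¹ * β := by positivity
    linarith
  have herr : (1 + m) * (ε * (α + β)) ≤ θ * (β + m * α) := by
    calc (1 + m) * (ε * (α + β)) ≤ (1 + m) * (ε * ((1 + m⁻¹) * (β + m * α))) := by gcongr
      _ = ε * ((1 + m) * (1 + m⁻¹)) * (β + m * α) := by ring
      _ ≤ θ * (β + m * α) := by gcongr
  have c1 := mul_le_mul_of_nonneg_left (abs_le.1 h1).2 hm.le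
  have c2 := (abs_le.1 h2).1
  have hkw : k * (β + m * α) = d * β - c * -α - m * (a * -α - b * β) := by
    linear_combination -β * hdk - α * hck
  linarith

/-- Near the tangent direction `t` is close to `m * s`, so `a * s - b * t = l * s - b * (t - m * s)`
is close to `l * s`. Each of the two errors is allotted `θ / 2`. -/
theorem contraction_of_tangent {a b m l ε η ν θ s t X : ℝ} (hb : 0 < b) (hl : 0 ≤ l)
    (hε : 0 < ε) (hν : ν = 1 + m + η) (hal : a - b * m = l) (hηb : η * b ≤ θ / 2)
    (hεν : ε * ν ≤ θ / 2) (htan : |t - m * s| ≤ η * |s|) (htabs : |t| ≤ (m + η) * |s|)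
    (h1 : |X - (a * s - b * t)| ≤ ε * (|s| + |t|)) : |X| ≤ (l + θ) * |s| := by
  have hsum : ε * (|s| + |t|) ≤ θ / 2 * |s| := by
    calc ε * (|s| + |t|) ≤ ε * (ν * |s|) := by
          gcongr
          rw [hν]
          linarith
      _ = ε * ν * |s| := by ring
      _ ≤ θ / 2 * |s| := by gcongr
  have hb' : b * |t - m * s| ≤ θ / 2 * |s| := by
    calc b * |t - m * s| ≤ b * (η * |s|) := by gcongr
      _ = η * b * |s| := by ring
      _ ≤ θ / 2 * |s| := by gcongr
  have e : X = (X - (a * s - b * t)) + l * s + -(b * (t - m * s)) := by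
    linear_combination s * hal
  have h3 := abs_add_three (X - (a * s - b * t)) (l * s) (-(b * (t - m * s)))
  rw [← e, abs_neg, abs_mul, abs_mul, abs_of_nonneg hl, abs_of_pos hb] at h3
  linarith

/-- Near a fixed point `x` of `S` whose derivative maps the closed second quadrant, minus the
origin, into the open one, consider an orbit `y` which converges to `x` along the weaker
eigendirection. Orbits starting close to `x` on the north-west side of `y` enter the open second
quadrant of `x`, because the dominant eigenvalue governs `z - y`. -/
theorem exists_mem_quadrant2_of_orbit {S : ℝ × ℝ → ℝ × ℝ} {L : ℝ × ℝ →L[ℝ] ℝ × ℝ} {x : ℝ × ℝ}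
    (hS : HasStrictFDerivAt S L x) (hSx : S x = x) {a b c d m l k : ℝ}
    (hL : ∀ u v, L (u, v) = (a * u - b * v, d * v - c * u)) (ha : 0 < a) (hb : 0 < b)
    (hc : 0 < c) (hd : 0 < d) (hm : 0 < m) (hl : 0 ≤ l) (hlk : l < k) (hal : a - b * m = l)
    (hdk : d + m * b = k) (hck : c + m * a = m * k) :
    ∃ δ > 0, ∃ η > 0, ∀ y z : ℕ → ℝ × ℝ, (∀ n, y (n + 1) = S (y n)) → (∀ n, z (n + 1) = S (z n)) →
      (∀ n, dist (y n) x < δ) → dist (z 0) x < δ →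
      (∀ n, |(y n).2 - x.2 - m * ((y n).1 - x.1)| ≤ η * |(y n).1 - x.1|) →
      (∀ n, SELE (z n) (y n)) → z 0 ≠ y 0 → ∃ n, (z n).1 < x.1 ∧ x.2 < (z n).2 := by
  obtain ⟨κ, hκ, hκa, hκb, hκc, hκd⟩ : ∃ κ > 0, κ ≤ a ∧ κ ≤ b ∧ κ ≤ c ∧ κ ≤ d :=
    ⟨min (min a b) (min c d), by positivity, by simp, by simp, by simp, by simp⟩
  -- The margin `θ` keeps the perturbed contraction rate `l + θ` below the perturbed growth rate `k
  -- - θ`.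
  obtain ⟨θ, hθ, hθlk⟩ : ∃ θ > 0, l + θ < k - θ := ⟨(k - l) / 3, by linarith, by linarith⟩
  obtain ⟨η, hη, hηb⟩ := exists_pos_mul_le b (half_pos hθ)
  obtain ⟨ν, hν⟩ : ∃ ν, ν = 1 + m + η := ⟨_, rfl⟩
  have hνpos : 0 < ν := by rw [hν]; positivity
  obtain ⟨ε₁, hε₁, hε₁'⟩ := exists_pos_mul_le ν (half_pos hθ)
  obtain ⟨ε₂, hε₂, hε₂'⟩ := exists_pos_mul_le ((1 + m) * (1 + m⁻¹)) hθ
  obtain ⟨ε, hε, hεν, hεm, hεκ⟩ : ∃ ε > 0, ε * ν ≤ θ / 2 ∧ ε * ((1 + m) * (1 + m⁻¹)) ≤ θ ∧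
      ε ≤ κ / 2 := by
    refine ⟨min (min ε₁ ε₂) (κ / 2), by positivity, ?_, ?_, min_le_right _ _⟩
    · refine le_trans ?_ hε₁'
      gcongr
      exact (min_le_left _ _).trans (min_le_left _ _)
    · refine le_trans ?_ hε₂'
      gcongr
      exact (min_le_left _ _).trans (min_le_right _ _)
  obtain ⟨δ₀, hδ₀, happ⟩ := hS.exists_pos_norm_sub_le hε
  have hcoord : ∀ p q, dist p x < δ₀ → dist q x < δ₀ → ∀ u v, p.1 - q.1 = u → p.2 - q.2 = v →
      |(S p).1 - (S q).1 - (a * u - b * v)| ≤ ε * (|u| + |v|) ∧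
      |(S p).2 - (S q).2 - (d * v - c * u)| ≤ ε * (|u| + |v|) := by
    rintro p q hp hq u v rfl rfl
    have h := happ p q hp hq
    have hLpq : L (p - q) = _ := hL (p.1 - q.1) (p.2 - q.2)
    rw [hLpq] at h
    have hn : ‖p - q‖ ≤ |p.1 - q.1| + |p.2 - q.2| := by
      rw [Prod.norm_def]
      exact max_le (le_add_of_nonneg_right (abs_nonneg _)) (le_add_of_nonneg_left (abs_nonneg _))
    have h' := h.trans (mul_le_mul_of_nonneg_left hn hε.le)
    exact ⟨(norm_fst_le _).trans h', (norm_snd_le _).trans h'⟩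
  obtain ⟨δ₁, hδ₁, hδ₁₀, hmap⟩ : ∃ δ₁ > 0, δ₁ ≤ δ₀ ∧ ∀ p, dist p x < δ₁ → dist (S p) x < δ₀ := by
    have := Metric.continuousAt_iff.1 hS.hasFDerivAt.continuousAt δ₀ hδ₀
    rw [hSx] at this
    obtain ⟨δ₁, h1, h2⟩ := this
    exact ⟨min δ₁ δ₀, by positivity, min_le_right _ _,
      fun p hp => h2 (hp.trans_le (min_le_left _ _))⟩
  -- `G` is the coefficient of `|s|` in `quadrant2_of_large_deviation`, and `M = 2 * G / κ` is the
  -- resulting threshold for `(α + β) / |s|`.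
  obtain ⟨G, hG⟩ : ∃ G, G = (a + b + c + d) * ν + ε * ν := ⟨_, rfl⟩
  have hGpos : 0 < G := by rw [hG]; positivity
  obtain ⟨M, hM⟩ : ∃ M, M = 2 * G / κ := ⟨_, rfl⟩
  have hMpos : 0 < M := by rw [hM]; positivity
  have hMκ : κ / 2 * M = G := by rw [hM]; field_simp
  -- While the deviation is at most `M * |s|`, the point `z n` is within `|s| * (ν + M)` of `x`;
  -- this radius keeps that below `δ₁`, so the next iterate stays in the `δ₀`-ball.
  refine ⟨min δ₀ (δ₁ / (ν + M)), by positivity, η, hη, ?_⟩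
  intro y z hy hz hyδ hz0 htan hle hne
  by_contra! hcon
  have hyδ₀ : ∀ n, dist (y n) x < δ₀ := fun n => (hyδ n).trans_le (min_le_left _ _)
  obtain ⟨s, hs⟩ : ∃ s : ℕ → ℝ, ∀ n, s n = (y n).1 - x.1 := ⟨_, fun n => rfl⟩
  obtain ⟨t, ht⟩ : ∃ t : ℕ → ℝ, ∀ n, t n = (y n).2 - x.2 := ⟨_, fun n => rfl⟩
  obtain ⟨α, hα⟩ : ∃ α : ℕ → ℝ, ∀ n, α n = (y n).1 - (z n).1 := ⟨_, fun n => rfl⟩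
  obtain ⟨β, hβ⟩ : ∃ β : ℕ → ℝ, ∀ n, β n = (z n).2 - (y n).2 := ⟨_, fun n => rfl⟩
  have hα0 : ∀ n, 0 ≤ α n := fun n => by rw [hα]; exact sub_nonneg.2 (hle n).1
  have hβ0 : ∀ n, 0 ≤ β n := fun n => by rw [hβ]; exact sub_nonneg.2 (hle n).2
  have htan' : ∀ n, |t n - m * s n| ≤ η * |s n| := fun n => by
    rw [hs, ht]
    exact htan n
  have htabs : ∀ n, |t n| ≤ (m + η) * |s n| := fun n => by
    have h1 : |t n| ≤ |t n - m * s n| + |m * s n| := by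
      simpa using abs_add_le (t n - m * s n) (m * s n)
    rw [abs_mul, abs_of_pos hm] at h1
    linarith only [htan' n, h1]
  have hsδ : ∀ n, |s n| * (ν + M) < δ₁ := fun n => by
    have h1 : |s n| ≤ dist (y n) x := by
      rw [hs, Prod.dist_eq]
      exact le_max_left _ _
    have h2 := h1.trans_lt ((hyδ n).trans_le (min_le_right _ _))
    rwa [lt_div_iff₀ (by positivity)] at h2
  -- a large deviation from `y` forces the next iterate into the open quadrant
  have hsmall : ∀ n, dist (z n) x < δ₀ → α n + β n ≤ M * |s n| := by
    intro n hn
    by_contra! hbig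
    have hu : (z n).1 - x.1 = s n - α n := by rw [hs, hα]; ring
    have hv : (z n).2 - x.2 = t n + β n := by rw [ht, hβ]; ring
    obtain ⟨h1, h2⟩ := hcoord (z n) x hn (by simpa using hδ₀) _ _ hu hv
    rw [hSx, ← hz n] at h1 h2
    obtain ⟨r1, r2⟩ := quadrant2_of_large_deviation ha hb hc hd hκa hκb hκc hκd hε hεκ hν
      hm.le hη.le (hα0 n) (hβ0 n) (htabs n) (by rw [← hG, ← hMκ, mul_assoc]; gcongr) h1 h2
    rw [sub_neg] at r1
    rw [sub_pos] at r2
    exact (hcon (n + 1) r1).not_gt r2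
  have hzδ : ∀ n, dist (z n) x < δ₀ := by
    intro n
    induction n with
    | zero => exact hz0.trans_le (min_le_left _ _)
    | succ n ih =>
      rw [hz]
      refine hmap _ ((?_ : dist (z n) x ≤ |s n| * (ν + M)).trans_lt (hsδ n))
      have hu : (z n).1 - x.1 = s n - α n := by rw [hs, hα]; ring
      have hv : (z n).2 - x.2 = t n + β n := by rw [ht, hβ]; ring
      rw [Prod.dist_eq, Real.dist_eq, Real.dist_eq, hu, hv, hν]
      exact abs_sub_add_le_of_deviation (hα0 n) (hβ0 n) (by positivity) (htabs n) (hsmall n ih)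
  obtain ⟨w, hw⟩ : ∃ w : ℕ → ℝ, ∀ n, w n = β n + m * α n := ⟨_, fun n => rfl⟩
  have hw0 : 0 < w 0 := by
    rw [hw]
    refine lt_of_le_of_ne (add_nonneg (hβ0 0) (mul_nonneg hm.le (hα0 0))) fun he => hne ?_
    obtain ⟨h2, h1⟩ := (add_eq_zero_iff_of_nonneg (hβ0 0) (mul_nonneg hm.le (hα0 0))).1 he.symm
    have h1 := (mul_eq_zero.1 h1).resolve_left hm.ne'
    rw [hα, sub_eq_zero] at h1
    rw [hβ, sub_eq_zero] at h2
    exact Prod.ext h1.symm h2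
  have hwgrow : ∀ n, (k - θ) * w n ≤ w (n + 1) := by
    intro n
    have hu : (z n).1 - (y n).1 = -α n := by rw [hα]; ring
    have hv : (z n).2 - (y n).2 = β n := by rw [hβ]
    obtain ⟨h1, h2⟩ := hcoord (z n) (y n) (hzδ n) (hyδ₀ n) _ _ hu hv
    rw [← hz n, ← hy n, abs_neg, abs_of_nonneg (hα0 n), abs_of_nonneg (hβ0 n)] at h1 h2
    have hw1 : w (n + 1) = (z (n + 1)).2 - (y (n + 1)).2 -
        m * ((z (n + 1)).1 - (y (n + 1)).1) := by rw [hw, hα, hβ]; ring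
    rw [hw1, hw]
    exact growth_of_deviation hm hε hdk hck hεm (hα0 n) (hβ0 n) h1 h2
  have hscon : ∀ n, |s (n + 1)| ≤ (l + θ) * |s n| := by
    intro n
    obtain ⟨h1, -⟩ := hcoord (y n) x (hyδ₀ n) (by simpa using hδ₀) _ _ (hs n).symm (ht n).symm
    rw [hSx, ← hy n, ← hs (n + 1)] at h1
    exact contraction_of_tangent hb hl hε hν hal hηb hεν (htan' n) (htabs n) h1
  have hk : 0 < k - θ := by linarith only [hl, hθ, hθlk]
  have hwpow : ∀ n, (k - θ) ^ n * w 0 ≤ w n := by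
    intro n
    induction n with
    | zero => simp
    | succ n ih =>
      calc (k - θ) ^ (n + 1) * w 0 = (k - θ) * ((k - θ) ^ n * w 0) := by ring
        _ ≤ (k - θ) * w n := by gcongr
        _ ≤ w (n + 1) := hwgrow n
  have hspow : ∀ n, |s n| ≤ (l + θ) ^ n * |s 0| := by
    intro n
    induction n with
    | zero => simp
    | succ n ih =>
      calc |s (n + 1)| ≤ (l + θ) * |s n| := hscon n
        _ ≤ (l + θ) * ((l + θ) ^ n * |s 0|) := by gcongr
        _ = (l + θ) ^ (n + 1) * |s 0| := by ring
  -- If `z` never entered the quadrant, `w n` would grow at least like `(k - θ) ^ n` and yet be at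
  -- most a multiple of `|s n|`, hence of `(l + θ) ^ n`.
  have hbound : ∀ n, w 0 ≤ (1 + m) * M * |s 0| * ((l + θ) / (k - θ)) ^ n := by
    intro n
    have h1 : w n ≤ (1 + m) * (α n + β n) := by
      rw [hw]
      linarith only [hα0 n, mul_nonneg hm.le (hβ0 n)]
    have h2 : w n ≤ (1 + m) * (M * ((l + θ) ^ n * |s 0|)) := by
      refine h1.trans ?_
      gcongr
      exact (hsmall n (hzδ n)).trans (by gcongr; exact hspow n)
    have h3 := (hwpow n).trans h2
    rw [div_pow, ← mul_div_assoc, le_div_iff₀ (by positivity)]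
    linarith only [h3]
  have hlim : Tendsto (fun n : ℕ => (1 + m) * M * |s 0| * ((l + θ) / (k - θ)) ^ n) atTop (𝓝 0) := by
    have := (tendsto_pow_atTop_nhds_zero_of_lt_one (r := (l + θ) / (k - θ)) (by positivity)
      ((div_lt_one hk).2 hθlk)).const_mul ((1 + m) * M * |s 0|)
    simpa using this
  exact hw0.not_ge (ge_of_tendsto hlim (Eventually.of_forall hbound))

/-- The reflection `v ↦ -v` exchanges the second and fourth quadrants and leaves the derivative
unchanged, so the previous result applies to `v ↦ -S (-v)`. -/
theorem exists_mem_quadrant4_of_orbit {S : ℝ × ℝ → ℝ × ℝ} {L : ℝ × ℝ →L[ℝ] ℝ × ℝ} {x : ℝ × ℝ}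
    (hS : HasStrictFDerivAt S L x) (hSx : S x = x) {a b c d m l k : ℝ}
    (hL : ∀ u v, L (u, v) = (a * u - b * v, d * v - c * u)) (ha : 0 < a) (hb : 0 < b)
    (hc : 0 < c) (hd : 0 < d) (hm : 0 < m) (hl : 0 ≤ l) (hlk : l < k) (hal : a - b * m = l)
    (hdk : d + m * b = k) (hck : c + m * a = m * k) :
    ∃ δ > 0, ∃ η > 0, ∀ y z : ℕ → ℝ × ℝ, (∀ n, y (n + 1) = S (y n)) → (∀ n, z (n + 1) = S (z n)) →
      (∀ n, dist (y n) x < δ) → dist (z 0) x < δ →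
      (∀ n, |(y n).2 - x.2 - m * ((y n).1 - x.1)| ≤ η * |(y n).1 - x.1|) →
      (∀ n, SELE (y n) (z n)) → z 0 ≠ y 0 → ∃ n, x.1 < (z n).1 ∧ (z n).2 < x.2 := by
  have hS' : HasStrictFDerivAt (fun v => -S (-v)) L (-x) := by
    have h1 : HasStrictFDerivAt S L (-(-x)) := by rwa [neg_neg]
    convert! (h1.comp (-x) (hasStrictFDerivAt_id (-x)).neg).neg using 1
    ext <;> simp
  obtain ⟨δ, hδ, η, hη, H⟩ := exists_mem_quadrant2_of_orbit hS' (by simp [hSx]) hL ha hb hc hd hm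
    hl hlk hal hdk hck
  refine ⟨δ, hδ, η, hη, fun y z hy hz hyδ hzδ htan hle hne => ?_⟩
  obtain ⟨n, h1, h2⟩ := H (fun n => -y n) (fun n => -z n)
    (fun n => by simp [hy]) (fun n => by simp [hz])
    (fun n => by simpa using hyδ n) (by simpa using hzδ)
    (fun n => by
      have e1 : (-y n).2 - (-x).2 - m * ((-y n).1 - (-x).1) =
        -((y n).2 - x.2 - m * ((y n).1 - x.1)) := by simp only [Prod.fst_neg, Prod.snd_neg]; ring
      have e2 : (-y n).1 - (-x).1 = -((y n).1 - x.1) := by simp only [Prod.fst_neg]; ring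
      rw [e1, e2, abs_neg, abs_neg]
      exact htan n)
    (fun n => ⟨neg_le_neg (hle n).1, neg_le_neg (hle n).2⟩) (fun he => hne (neg_injective he))
  exact ⟨n, neg_lt_neg_iff.1 h1, neg_lt_neg_iff.1 h2⟩

/-! ### Escape of both sides into the open quadrants -/

section Escape

variable {T : ℝ × ℝ → ℝ × ℝ} {R C : Set (ℝ × ℝ)} {x : ℝ × ℝ} {lam mu : ℝ}

theorem nonpos_of_eventually_antitoneOn {g : ℝ → ℝ} {g' : ℝ} {s : Set ℝ} (hs : s ∈ 𝓝 0)
    (hg : HasDerivAt g g' 0) (hanti : AntitoneOn g s) : g' ≤ 0 := by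
  refine hg.hasDerivWithinAt.nonpos_of_antitoneOn (s := s) ?_ hanti
  have hle : 𝓝[≠] (0 : ℝ) ≤ 𝓟 s := le_principal_iff.2 (mem_nhdsWithin_of_mem_nhds hs)
  rw [AccPt, inf_eq_left.2 hle]
  infer_instance

/-- The off-diagonal entries of the Jacobian of a competitive map are nonpositive. -/
theorem CompetitiveOn.fderiv_apply_nonpos {L : ℝ × ℝ →L[ℝ] ℝ × ℝ} (hT : CompetitiveOn T R)
    (hR : R ∈ 𝓝 x) (hL : HasFDerivAt T L x) : (L (0, 1)).1 ≤ 0 ∧ (L (1, 0)).2 ≤ 0 := by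
  have hpath : ∀ e : ℝ × ℝ, HasDerivAt (fun t : ℝ => T (x + t • e)) (L e) 0 := by
    intro e
    have h1 : HasDerivAt (fun t : ℝ => x + t • e) e 0 := by
      simpa using ((hasDerivAt_id (0 : ℝ)).smul_const e).const_add x
    have h2 : HasFDerivAt T L (x + (0 : ℝ) • e) := by simpa using hL
    exact h2.comp_hasDerivAt (0 : ℝ) h1
  have hmem : ∀ e : ℝ × ℝ, {t : ℝ | x + t • e ∈ R} ∈ 𝓝 (0 : ℝ) := by
    intro e
    have hc : ContinuousAt (fun t : ℝ => x + t • e) 0 := by fun_prop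
    exact hc.preimage_mem_nhds (by simpa using hR)
  constructor
  · refine nonpos_of_eventually_antitoneOn (hmem (0, 1))
      (g := fun t => (T (x + t • ((0 : ℝ), (1 : ℝ)))).1) ?_ ?_
    · exact (hasFDerivAt_fst (𝕜 := ℝ)).comp_hasDerivAt (0 : ℝ) (hpath (0, 1))
    · intro s hs t ht hst
      have e : ∀ r : ℝ, x + r • ((0 : ℝ), (1 : ℝ)) = (x.1, x.2 + r) := fun r => by
        ext <;> simp
      simp only [mem_ofPred_eq, e] at hs ht ⊢
      exact (hT.2 _ _ _ hs ht (by linarith)).1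
  · refine nonpos_of_eventually_antitoneOn (hmem (1, 0))
      (g := fun t => (T (x + t • ((1 : ℝ), (0 : ℝ)))).2) ?_ ?_
    · exact (hasFDerivAt_snd (𝕜 := ℝ)).comp_hasDerivAt (0 : ℝ) (hpath (1, 0))
    · intro s hs t ht hst
      have e : ∀ r : ℝ, x + r • ((1 : ℝ), (0 : ℝ)) = (x.1 + r, x.2) := fun r => by
        ext <;> simp
      simp only [mem_ofPred_eq, e] at hs ht ⊢
      exact (hT.1 _ _ _ hs ht (by linarith)).2

/-- The slope of the tangent line of the invariant curve is positive. -/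
theorem CurveHypotheses.slope_pos (hT : CurveHypotheses T R x lam mu) {J : Set ℝ} {f : ℝ → ℝ}
    (h : IsIncreasingCurve C J f) (hxJ : x.1 ∈ J) {m : ℝ} (hm : HasDerivWithinAt f m J x.1)
    (hspan : (jacobianOn T R x).eigenspace lam = Submodule.span ℝ {((1 : ℝ), m)}) : 0 < m := by
  refine lt_of_le_of_ne (hm.nonneg_of_monotoneOn ?_ h.strictMono.monotoneOn) ?_
  · exact h.ordConnected.isPreconnected.preperfect_of_nontrivial h.nontrivial _ hxJ
  · rintro rfl
    exact hT.eigenspace_lam (Or.inl hspan)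

/-- If `E^μ` is not a coordinate axis, both off-diagonal entries of the Jacobian are nonzero. -/
theorem CurveHypotheses.offdiag_ne_zero (hT : CurveHypotheses T R x lam mu) {b m : ℝ}
    (hm : m ≠ 0) (hb : ∀ u v : ℝ, fderivWithin ℝ T R x (u, v) =
      ((lam - b * m) * u + b * v, m * (lam - mu - b * m) * u + (mu + b * m) * v))
    (hmu : ¬ IsCoordinateAxis ((jacobianOn T R x).eigenspace mu)) :
    b ≠ 0 ∧ m * (lam - mu - b * m) ≠ 0 := by
  have hlm : lam - mu ≠ 0 := sub_ne_zero.2 ((le_abs_self lam).trans_lt hT.abs_lam_lt_mu).ne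
  have hmem : ∀ u v : ℝ, (u, v) ∈ (jacobianOn T R x).eigenspace mu ↔
      (lam - b * m) * u + b * v = mu * u ∧
        m * (lam - mu - b * m) * u + (mu + b * m) * v = mu * v := by
    intro u v
    rw [Module.End.mem_eigenspace_iff]
    change fderivWithin ℝ T R x (u, v) = _ ↔ _
    rw [hb, Prod.smul_mk, Prod.mk.injEq, smul_eq_mul, smul_eq_mul]
  constructor
  -- For `b = 0` the vertical axis would be the `mu`-eigenspace; a zero lower-left entry below makes
  -- it the horizontal axis.
  · rintro rfl
    refine hmu (Or.inr ?_)
    ext ⟨u, v⟩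
    rw [hmem, Submodule.mem_span_singleton]
    constructor
    · rintro ⟨h1, -⟩
      have hu : u = 0 := by
        refine (mul_eq_zero.1 (?_ : (lam - mu) * u = 0)).resolve_left hlm
        linear_combination h1
      exact ⟨v, by simp [hu]⟩
    · rintro ⟨r, hr⟩
      simp only [Prod.smul_mk, smul_eq_mul, mul_zero, mul_one, Prod.mk.injEq] at hr
      obtain ⟨rfl, rfl⟩ := hr
      constructor <;> ring
  · intro hc
    have hbm : lam - mu - b * m = 0 := (mul_eq_zero.1 hc).resolve_left hm
    refine hmu (Or.inl ?_)
    ext ⟨u, v⟩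
    rw [hmem, Submodule.mem_span_singleton]
    constructor
    · rintro ⟨-, h2⟩
      have hv : v = 0 := by
        refine (mul_eq_zero.1 (?_ : (lam - mu) * v = 0)).resolve_left hlm
        linear_combination h2 + (v - m * u) * hbm
      exact ⟨u, by simp [hv]⟩
    · rintro ⟨r, hr⟩
      simp only [Prod.smul_mk, smul_eq_mul, mul_zero, mul_one, Prod.mk.injEq] at hr
      obtain ⟨rfl, rfl⟩ := hr
      constructor
      · linear_combination r * hbm
      · linear_combination m * r * hbm

/-- The derivative of `T²` at `x` maps the closed second quadrant, minus the origin, into the open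
second quadrant, and has the eigenvalues `lam²`, `mu²`. -/
theorem CurveHypotheses.exists_fderiv_iterate_two (hT : CurveHypotheses T R x lam mu)
    (hR : R ∈ 𝓝 x) (hd : ContDiffAt ℝ 1 T x)
    (hmu : ¬ IsCoordinateAxis ((jacobianOn T R x).eigenspace mu)) {m : ℝ} (hm : 0 < m)
    (hspan : (jacobianOn T R x).eigenspace lam = Submodule.span ℝ {((1 : ℝ), m)}) :
    ∃ (L : ℝ × ℝ →L[ℝ] ℝ × ℝ) (a b c d : ℝ), HasStrictFDerivAt T^[2] L x ∧
      (∀ u v, L (u, v) = (a * u - b * v, d * v - c * u)) ∧ 0 < a ∧ 0 < b ∧ 0 < c ∧ 0 < d ∧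
      a - b * m = lam ^ 2 ∧ d + m * b = mu ^ 2 ∧ c + m * a = m * mu ^ 2 := by
  obtain ⟨b, hb⟩ := hT.exists_fderivWithin_apply hspan
  have hstrict : HasStrictFDerivAt T (fderivWithin ℝ T R x) x := by
    rw [fderivWithin_of_mem_nhds hR]
    exact hd.hasStrictFDerivAt (by simp)
  obtain ⟨hb0, hc0⟩ := hT.competitive.fderiv_apply_nonpos hR hstrict.hasFDerivAt
  obtain ⟨hbne, hcne⟩ := hT.offdiag_ne_zero hm.ne' hb hmu
  rw [hb] at hb0 hc0
  simp only [mul_zero, mul_one, zero_add, add_zero] at hb0 hc0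
  have hbneg : b < 0 := lt_of_le_of_ne hb0 hbne
  have hcneg : m * (lam - mu - b * m) < 0 := lt_of_le_of_ne hc0 hcne
  have htr : 0 < lam + mu := by linarith [neg_abs_le lam, hT.abs_lam_lt_mu]
  have hbc := mul_pos_of_neg_of_neg hbneg hcneg
  have hstrict2 : HasStrictFDerivAt T^[2]
      ((fderivWithin ℝ T R x).comp (fderivWithin ℝ T R x)) x := by
    have h1 : HasStrictFDerivAt T (fderivWithin ℝ T R x) (T x) := by rwa [hT.fixed]
    exact h1.comp x hstrict
  -- Squaring makes `lam ^ 2` nonnegative and all four entries nonzero: the diagonal ones are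
  -- squares plus the positive product of the off-diagonal entries, and the off-diagonal ones are
  -- multiplied by the positive trace `lam + mu`.
  refine ⟨_, (lam - b * m) ^ 2 + b * (m * (lam - mu - b * m)), -b * (lam + mu),
    -(m * (lam - mu - b * m)) * (lam + mu), (mu + b * m) ^ 2 + b * (m * (lam - mu - b * m)),
    hstrict2, ?_, by positivity, mul_pos (neg_pos.2 hbneg) htr, mul_pos (neg_pos.2 hcneg) htr,
    by positivity, by ring, by ring, by ring⟩
  intro u v
  rw [ContinuousLinearMap.comp_apply, hb, hb]
  ext <;> simp only <;> ring

theorem IsIncreasingCurve.eventually_tangent {J : Set ℝ} {f : ℝ → ℝ}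
    (h : IsIncreasingCurve C J f) (hx : x ∈ C) {m : ℝ} (hm : HasDerivWithinAt f m J x.1)
    {y : ℕ → ℝ × ℝ} (hy : ∀ n, y n ∈ C) (hlim : Tendsto y atTop (𝓝 x)) {η : ℝ} (hη : 0 < η) :
    ∀ᶠ n in atTop, |(y n).2 - x.2 - m * ((y n).1 - x.1)| ≤ η * |(y n).1 - x.1| := by
  have hw : Tendsto (fun n => (y n).1) atTop (𝓝[J] x.1) :=
    tendsto_nhdsWithin_iff.2 ⟨(continuous_fst.tendsto x).comp hlim,
      Eventually.of_forall fun n => (h.mem_iff.1 (hy n)).1⟩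
  filter_upwards [hw.eventually ((hasDerivWithinAt_iff_isLittleO.1 hm).def hη)] with n hn
  rw [(h.mem_iff.1 (hy n)).2, (h.mem_iff.1 hx).2, smul_eq_mul, Real.norm_eq_abs,
    Real.norm_eq_abs] at hn
  rwa [mul_comm m]

theorem mem_interior_quadrant2 {p : ℝ × ℝ} (h1 : p.1 < x.1) (h2 : x.2 < p.2) :
    p ∈ interior (quadrant2 x) :=
  mem_interior.2 ⟨Iio x.1 ×ˢ Ioi x.2, fun _ hq => ⟨le_of_lt hq.1, le_of_lt hq.2⟩,
    isOpen_Iio.prod isOpen_Ioi, h1, h2⟩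

theorem mem_interior_quadrant4 {p : ℝ × ℝ} (h1 : x.1 < p.1) (h2 : p.2 < x.2) :
    p ∈ interior (quadrant4 x) :=
  mem_interior.2 ⟨Ioi x.1 ×ˢ Iio x.2, fun _ hq => ⟨le_of_lt hq.1, le_of_lt hq.2⟩,
    isOpen_Ioi.prod isOpen_Iio, h1, h2⟩

theorem iterate_two_iterate (T : ℝ × ℝ → ℝ × ℝ) (n N : ℕ) (p : ℝ × ℝ) :
    (T^[2])^[n] (T^[N] p) = T^[2 * n + N] p := by
  rw [← Function.iterate_mul, Function.iterate_add_apply]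

/-- The orbit of `p` need not approach `x`, so the local result is applied to a point `z` of the
segment from `T^[N] y` to `T^[N] p` close to the curve. Since `T^[N] p` is north-west of `z`, it
enters the quadrant with `z`, and `iterate_lt` keeps it there. -/
theorem CurveHypotheses.eventually_mem_quadrant2 (hT : CurveHypotheses T R x lam mu)
    (hC : IsInvariantCurve T R x lam C) {U : Set (ℝ × ℝ)} (hU : U ∈ 𝓝 x) (hUR : U ⊆ R)
    (hs : StronglyCompetitiveOn T U) (hd : ContDiffAt ℝ 1 T x)
    (hmu : ¬ IsCoordinateAxis ((jacobianOn T R x).eigenspace mu)) {p : ℝ × ℝ}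
    (hp : p ∈ wMinus R C) : ∃ n₀ : ℕ, ∀ n ≥ n₀, T^[n] p ∈ interior (quadrant2 x) := by
  obtain ⟨J, f, h, m, hm, hspan⟩ := hC.exists_isIncreasingCurve
  have hmpos := hT.slope_pos h (h.mem_iff.1 hC.mem).1 hm hspan
  obtain ⟨L, a, b, c, d, hL, hLuv, ha, hb, hc, hd', h1, h2, h3⟩ :=
    hT.exists_fderiv_iterate_two (mem_of_superset hU hUR) hd hmu hmpos hspan
  have hsq : lam ^ 2 < mu ^ 2 := sq_lt_sq.2 (hT.abs_lam_lt_mu.trans_le (le_abs_self mu))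
  obtain ⟨δ, hδ, η, hη, H⟩ := exists_mem_quadrant2_of_orbit hL
    (Function.IsFixedPt.iterate hT.fixed 2) hLuv ha hb hc hd' hmpos (sq_nonneg lam) hsq h1 h2 h3
  have hpW : ∀ n, T^[n] p ∈ wMinus R C := fun n => (hT.mapsTo_wMinus hC).iterate n hp
  obtain ⟨⟨hpR, -⟩, y, hy, hpy⟩ := hp
  have hyC : ∀ n, T^[n] y ∈ C := fun n => hC.invariant.iterate n hy
  -- After time `N` the orbit of `y` on the curve stays in the `δ`-ball and within the tangency cone
  -- of aperture `η`.
  obtain ⟨N, hN⟩ := eventually_atTop.1 (((hC.basin y hy).eventually (Metric.ball_mem_nhds x hδ)).and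
    (h.eventually_tangent hC.mem hm hyC (hC.basin y hy) hη))
  obtain ⟨t, ht, hz⟩ := exists_mem_near_segment
    (Metric.isOpen_ball.mem_nhds (hN N le_rfl).1) (T^[N] p)
  have hpyN := hT.sele_iterate hpR (hC.subset hy) hpy N
  have hyR := hC.subset (hyC N)
  have hzR := hT.rectangular.convex.add_smul_sub_mem hyR (hpW N).1.1 ⟨ht.1.le, ht.2.le⟩
  set z := T^[N] y + t • (T^[N] p - T^[N] y) with hzdef
  have hzy : SELE z (T^[N] y) := by
    constructor <;> simp [hzdef] <;> nlinarith [ht.1, ht.2, hpyN.1, hpyN.2]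
  have hpz : SELE (T^[N] p) z := by
    constructor <;> simp [hzdef] <;> nlinarith [ht.1, ht.2, hpyN.1, hpyN.2]
  have hne : z ≠ T^[N] y := by
    have : T^[N] p ≠ T^[N] y := fun he => (hpW N).1.2 (he ▸ hyC N)
    simp [hzdef, ht.1.ne', sub_eq_zero, this]
  obtain ⟨n, hn1, hn2⟩ := H (fun n => (T^[2])^[n] (T^[N] y)) (fun n => (T^[2])^[n] z)
    (fun n => Function.iterate_succ_apply' _ _ _) (fun n => Function.iterate_succ_apply' _ _ _)
    (fun n => by
      simp only [iterate_two_iterate]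
      exact (hN _ (Nat.le_add_left _ _)).1)
    hz
    (fun n => by
      simp only [iterate_two_iterate]
      exact (hN _ (Nat.le_add_left _ _)).2)
    (fun n => by
      simp only [← Function.iterate_mul]
      exact hT.sele_iterate hzR hyR hzy _)
    hne
  have hle : SELE (T^[2 * n + N] p) ((T^[2])^[n] z) := by
    rw [Function.iterate_add_apply, ← Function.iterate_mul]
    exact hT.sele_iterate (hpW N).1.1 hzR hpz _
  have hlt : (T^[2 * n + N] p).1 < x.1 := hle.1.trans_lt hn1
  have hgt : x.2 < (T^[2 * n + N] p).2 := hn2.trans_le hle.2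
  -- `iterate_lt` speaks of iterates of order at least one, which accounts for the extra `1`.
  refine ⟨2 * n + N + 1, fun k hk => ?_⟩
  obtain ⟨j, rfl⟩ := Nat.exists_eq_add_of_le hk
  have hit := hT.iterate_lt hU hUR hs (hpW (2 * n + N)).1.1 ⟨hlt.le, hgt.le⟩
    (fun he => hlt.ne (congrArg Prod.fst he)) j
  rw [← Function.iterate_add_apply, show j + 1 + (2 * n + N) = 2 * n + N + 1 + j by ring] at hit
  exact mem_interior_quadrant2 hit.1 hit.2

theorem CurveHypotheses.eventually_mem_quadrant4 (hT : CurveHypotheses T R x lam mu)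
    (hC : IsInvariantCurve T R x lam C) {U : Set (ℝ × ℝ)} (hU : U ∈ 𝓝 x) (hUR : U ⊆ R)
    (hs : StronglyCompetitiveOn T U) (hd : ContDiffAt ℝ 1 T x)
    (hmu : ¬ IsCoordinateAxis ((jacobianOn T R x).eigenspace mu)) {p : ℝ × ℝ}
    (hp : p ∈ wPlus R C) : ∃ n₀ : ℕ, ∀ n ≥ n₀, T^[n] p ∈ interior (quadrant4 x) := by
  obtain ⟨J, f, h, m, hm, hspan⟩ := hC.exists_isIncreasingCurve
  have hmpos := hT.slope_pos h (h.mem_iff.1 hC.mem).1 hm hspan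
  obtain ⟨L, a, b, c, d, hL, hLuv, ha, hb, hc, hd', h1, h2, h3⟩ :=
    hT.exists_fderiv_iterate_two (mem_of_superset hU hUR) hd hmu hmpos hspan
  have hsq : lam ^ 2 < mu ^ 2 := sq_lt_sq.2 (hT.abs_lam_lt_mu.trans_le (le_abs_self mu))
  obtain ⟨δ, hδ, η, hη, H⟩ := exists_mem_quadrant4_of_orbit hL
    (Function.IsFixedPt.iterate hT.fixed 2) hLuv ha hb hc hd' hmpos (sq_nonneg lam) hsq h1 h2 h3
  have hpW : ∀ n, T^[n] p ∈ wPlus R C := fun n => (hT.mapsTo_wPlus hC).iterate n hp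
  obtain ⟨⟨hpR, -⟩, y, hy, hyp⟩ := hp
  have hyC : ∀ n, T^[n] y ∈ C := fun n => hC.invariant.iterate n hy
  obtain ⟨N, hN⟩ := eventually_atTop.1 (((hC.basin y hy).eventually (Metric.ball_mem_nhds x hδ)).and
    (h.eventually_tangent hC.mem hm hyC (hC.basin y hy) hη))
  obtain ⟨t, ht, hz⟩ := exists_mem_near_segment
    (Metric.isOpen_ball.mem_nhds (hN N le_rfl).1) (T^[N] p)
  have hpyN := hT.sele_iterate (hC.subset hy) hpR hyp N
  have hyR := hC.subset (hyC N)
  have hzR := hT.rectangular.convex.add_smul_sub_mem hyR (hpW N).1.1 ⟨ht.1.le, ht.2.le⟩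
  set z := T^[N] y + t • (T^[N] p - T^[N] y) with hzdef
  have hyz : SELE (T^[N] y) z := by
    constructor <;> simp [hzdef] <;> nlinarith [ht.1, ht.2, hpyN.1, hpyN.2]
  have hzp : SELE z (T^[N] p) := by
    constructor <;> simp [hzdef] <;> nlinarith [ht.1, ht.2, hpyN.1, hpyN.2]
  have hne : z ≠ T^[N] y := by
    have : T^[N] p ≠ T^[N] y := fun he => (hpW N).1.2 (he ▸ hyC N)
    simp [hzdef, ht.1.ne', sub_eq_zero, this]
  obtain ⟨n, hn1, hn2⟩ := H (fun n => (T^[2])^[n] (T^[N] y)) (fun n => (T^[2])^[n] z)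
    (fun n => Function.iterate_succ_apply' _ _ _) (fun n => Function.iterate_succ_apply' _ _ _)
    (fun n => by
      simp only [iterate_two_iterate]
      exact (hN _ (Nat.le_add_left _ _)).1)
    hz
    (fun n => by
      simp only [iterate_two_iterate]
      exact (hN _ (Nat.le_add_left _ _)).2)
    (fun n => by
      simp only [← Function.iterate_mul]
      exact hT.sele_iterate hyR hzR hyz _)
    hne
  have hle : SELE ((T^[2])^[n] z) (T^[2 * n + N] p) := by
    rw [Function.iterate_add_apply, ← Function.iterate_mul]
    exact hT.sele_iterate hzR (hpW N).1.1 hzp _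
  have hlt : x.1 < (T^[2 * n + N] p).1 := hn1.trans_le hle.1
  have hgt : (T^[2 * n + N] p).2 < x.2 := hle.2.trans_lt hn2
  refine ⟨2 * n + N + 1, fun k hk => ?_⟩
  obtain ⟨j, rfl⟩ := Nat.exists_eq_add_of_le hk
  have hit := hT.lt_iterate hU hUR hs (hpW (2 * n + N)).1.1 ⟨hlt.le, hgt.le⟩
    (fun he => hlt.ne' (congrArg Prod.fst he)) j
  rw [← Function.iterate_add_apply, show j + 1 + (2 * n + N) = 2 * n + N + 1 + j by ring] at hit
  exact mem_interior_quadrant4 hit.1 hit.2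

end Escape

theorem theorem4 (T : ℝ × ℝ → ℝ × ℝ) (R : Set (ℝ × ℝ)) (xbar : ℝ × ℝ) (lam mu : ℝ)
    (hT : CurveHypotheses T R xbar lam mu)
    (C : Set (ℝ × ℝ)) (hC : Maximal (IsInvariantCurve T R xbar lam) C)
    (hend : ∀ p, IsCurveEndpoint C p → p ∈ frontier R) :
    -- part (A)
    (SeparatesInto C R (wMinus R C) (wPlus R C) ∧
      (MapsTo T (wMinus R C) (wMinus R C) ∧
        ∀ x ∈ wMinus R C,
          Tendsto (fun n : ℕ => Metric.infDist (T^[n] x) (quadrant2 xbar)) atTop (𝓝 0)) ∧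
      (MapsTo T (wPlus R C) (wPlus R C) ∧
        ∀ x ∈ wPlus R C,
          Tendsto (fun n : ℕ => Metric.infDist (T^[n] x) (quadrant4 xbar)) atTop (𝓝 0))) ∧
    -- part (B)
    (xbar ∈ interior R →
      (∃ U : Set (ℝ × ℝ), IsOpen U ∧ xbar ∈ U ∧ U ⊆ R ∧
        ContDiffOn ℝ 2 T U ∧ StronglyCompetitiveOn T U) →
      (∀ p ∈ R, p ∈ frontier (quadrant1 xbar ∪ quadrant3 xbar) →
        p ∈ Function.periodicPts T → p = xbar) ∧
      (¬ IsCoordinateAxis ((jacobianOn T R xbar).eigenspace mu) →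
        (∀ x ∈ wMinus R C, ∃ n₀ : ℕ, ∀ n ≥ n₀, T^[n] x ∈ interior (quadrant2 xbar)) ∧
        (∀ x ∈ wPlus R C, ∃ n₀ : ℕ, ∀ n ≥ n₀, T^[n] x ∈ interior (quadrant4 xbar)))) := by
  obtain ⟨J, f, h, -⟩ := hC.prop.exists_isIncreasingCurve
  refine ⟨⟨separatesInto_wMinus_wPlus hT.rectangular h hC.prop.subset hend
      fun p hp hpR => mem_of_isCurveEndpoint hT hC hend hp hpR,
    ⟨hT.mapsTo_wMinus hC.prop, fun p hp => hT.tendsto_infDist_quadrant2 hC.prop hp⟩,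
    ⟨hT.mapsTo_wPlus hC.prop, fun p hp => hT.tendsto_infDist_quadrant4 hC.prop hp⟩⟩, ?_⟩
  rintro - ⟨U, hU, hxU, hUR, hd, hs⟩
  have hUx := hU.mem_nhds hxU
  have hd1 : ContDiffAt ℝ 1 T xbar := (hd.contDiffAt hUx).of_le (by norm_num)
  exact ⟨fun p hp hf hper => hT.eq_of_mem_periodicPts hUx hUR hs hp hf hper, fun hmu =>
    ⟨fun p hp => hT.eventually_mem_quadrant2 hC.prop hUx hUR hs hd1 hmu hp,
      fun p hp => hT.eventually_mem_quadrant4 hC.prop hUx hUR hs hd1 hmu hp⟩⟩
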